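/- Let $m,p\ge 0$ be integers, $\sigma>0$, ${\bf A}\in\mathbb R^{m\times m}$ with all eigenvalues in the open unit disc, ${\bf B}\in\mathbb R^{m\times p}$, ${\bf Q}\in\mathbb R^{p\times p}$ symmetric positive semidefinite, and let ${\bf C}_0\in\mathbb R^{m\times m}$ be symmetric positive semidefinite with ${\bf C}_0={\bf A}{\bf C}_0{\bf A}^T+{\bf B}{\bf Q}{\bf B}^T$. Consider the stationary vector Gauss–Markov signal $$\vec s_{i+1}={\bf A}\vec s_i+{\bf B}\vec u_i,\qquad \vec s_1\sim\mathcal N(0,{\bf C}_0),\qquad \vec u_i\overset{\text{i.i.d.}}{\sim}\mathcal N(0,{\bf Q}),$$ and i.i.d. measurement noise $\vec w_i\sim\mathcal N(0,\sigma^2{\bf I}_m)$, where $\vec s_1$, $(\vec u_i)$ and $(\vec w_i)$ are independent, and the hypotheses $$H_0:\ \vec y_i=\vec w_i,\qquad H_1:\ \vec y_i=\vec s_i+\vec w_i,\qquad i=1,\dots,N .$$ For $\alpha\in(0,1)$ let $P_M^*(N,\alpha)$ be the infimum of the miss probability $P_M$ (the probability under $H_1$ of deciding $H_0$) over all, possibly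 randomized, tests based on $\vec y_1,\dots,\vec y_N$ whose false alarm probability satisfies $P_F\le\alpha$. For a symmetric matrix ${\bf P}$ put ${\bf R}_e=\sigma^2{\bf I}_m+{\bf P}$ and ${\bf K}_p={\bf A}{\bf P}{\bf R}_e^{-1}$. Let $\vec e_i=\vec y_i-\mathbb E_{H_1}[\vec y_i\mid \vec y_1,\dots,\vec y_{i-1}]$, as a function of the observations, be the innovation process. Then: 1. The discrete-time Riccati equation $${\bf P}={\bf A}{\bf P}{\bf A}^T+{\bf B}{\bf Q}{\bf B}^T-{\bf A}{\bf P}{\bf R}_e^{-1}{\bf P}{\bf A}^T$$ has a unique stabilizing solution (a symmetric solution ${\bf P}$ with ${\bf R}_e$ invertible and all eigenvalues of ${\bf A}-{\bf K}_p$ in the open unit disc), and it is positive semidefinite. From now on ${\bf P}$, ${\bf R}_e$, ${\bf K}_p$ refer to this solution. 2. The Lyapunov equation $\tilde{\bf P}=({\bf A}-{\bf K}_p)\tilde{\bf P}({\bf A}-{\bf K}_p)^T+{\bf K}_p{\bf K}_p^T$ has a unique positive semidefinite solution $\tilde{\bf P}$; put $\tilde{\bf R}_e=\sigma^2({\bf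 I}_m+\tilde{\bf P})$. 3. As $i\to\infty$, the covariance matrix of $\vec e_i$ converges to ${\bf R}_e$ under $H_1$ and to $\tilde{\bf R}_e$ under $H_0$. 4. For every $\alpha\in(0,1)$, $P_M^*(N,\alpha)>0$ for all $N$, and the best error exponent of the miss probability per vector observation is $$\lim_{N\to\infty}-\frac1N\log P_M^*(N,\alpha)=K_v=-\frac12\log\frac{\sigma^{2m}}{\det{\bf R}_e}+\frac12\operatorname{tr}\left({\bf R}_e^{-1}\tilde{\bf R}_e\right)-\frac m2,$$ independently of $\alpha$. -/

import Mathlib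

open MeasureTheory ProbabilityTheory Filter Topology

noncomputable section

/-- The data of the vector model: `s_{i+1} = A s_i + B u_i` with `s_1 ∼ N(0, C₀)`,
`u_i` i.i.d. `N(0, Q)`, and measurement noise `w_i` i.i.d. `N(0, σ² I)`. -/
structure VectorModel (m p : ℕ) where
  A : Matrix (Fin m) (Fin m) ℝ
  B : Matrix (Fin m) (Fin p) ℝ
  Q : Matrix (Fin p) (Fin p) ℝ
  C₀ : Matrix (Fin m) (Fin m) ℝ
  σ : ℝ

/-- All complex eigenvalues of the real matrix `F` lie in the open unit disc. -/
def IsStableMatrix {m : ℕ} (F : Matrix (Fin m) (Fin m) ℝ) : Prop :=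
  ∀ z ∈ spectrum ℂ (F.map (algebraMap ℝ ℂ)), ‖z‖ < 1

namespace VectorModel

variable {m p : ℕ} (M : VectorModel m p)

/-- The signal path driven by the initial state `s₁` and the input `u`. Time is indexed from `0`. -/
def signal (s₁ : EuclideanSpace ℝ (Fin m)) (u : ℕ → EuclideanSpace ℝ (Fin p)) :
    ℕ → EuclideanSpace ℝ (Fin m)
  | 0 => s₁
  | i + 1 => Matrix.toEuclideanLin M.A (signal s₁ u i) + Matrix.toEuclideanLin M.B (u i)

/-- The law of the measurement noise sequence. -/
def noiseLaw : Measure (ℕ → EuclideanSpace ℝ (Fin m)) :=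
  Measure.infinitePi fun _ => multivariateGaussian 0 (M.σ ^ 2 • (1 : Matrix (Fin m) (Fin m) ℝ))

/-- The law of the input sequence. -/
def inputLaw : Measure (ℕ → EuclideanSpace ℝ (Fin p)) :=
  Measure.infinitePi fun _ => multivariateGaussian 0 M.Q

/-- The law of the observations under `H₀ : y_i = w_i`. -/
def lawH0 : Measure (ℕ → EuclideanSpace ℝ (Fin m)) := M.noiseLaw

/-- The law of the observations under `H₁ : y_i = s_i + w_i`; the initial state, the input and the
measurement noise are independent. -/
def lawH1 : Measure (ℕ → EuclideanSpace ℝ (Fin m)) :=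
  ((multivariateGaussian 0 M.C₀).prod (M.inputLaw.prod M.noiseLaw)).map
    fun ω i => M.signal ω.1 ω.2.1 i + ω.2.2 i

/-- A (possibly randomized) test based on `N` vector observations: `φ y` is the probability of
deciding for `H₁` when `y` is observed. -/
def IsTest {m N : ℕ} (φ : (Fin N → EuclideanSpace ℝ (Fin m)) → ℝ) : Prop :=
  Measurable φ ∧ ∀ y, φ y ∈ Set.Icc (0 : ℝ) 1

/-- The false alarm probability `P_F` of a test. -/
def falseAlarmProb {N : ℕ} (φ : (Fin N → EuclideanSpace ℝ (Fin m)) → ℝ) : ℝ :=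
  ∫ y, φ (fun i : Fin N => y i) ∂M.lawH0

/-- The miss probability `P_M` of a test. -/
def missProb {N : ℕ} (φ : (Fin N → EuclideanSpace ℝ (Fin m)) → ℝ) : ℝ :=
  ∫ y, (1 - φ (fun i : Fin N => y i)) ∂M.lawH1

/-- The least miss probability among the tests with `N` vector observations and level `α`. -/
def optimalMissProb (α : ℝ) (N : ℕ) : ℝ :=
  sInf {β | ∃ φ : (Fin N → EuclideanSpace ℝ (Fin m)) → ℝ,
    IsTest φ ∧ M.falseAlarmProb φ ≤ α ∧ M.missProb φ = β}

/-- The σ-algebra generated by the observations before time `i`. -/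
abbrev past (m i : ℕ) : MeasurableSpace (ℕ → EuclideanSpace ℝ (Fin m)) :=
  MeasurableSpace.comap (fun y (j : Fin i) => y j) inferInstance

/-- The innovation at time `i`: the observation minus its conditional mean under `H₁` given the
earlier observations, as a function of the observation path. -/
def innovation (i : ℕ) (y : ℕ → EuclideanSpace ℝ (Fin m)) : EuclideanSpace ℝ (Fin m) :=
  y i - (M.lawH1[fun y => y i | past m i]) y

/-- The covariance matrix of the innovation at time `i` when the observations have law `μ`. -/
def innovationCov (μ : Measure (ℕ → EuclideanSpace ℝ (Fin m))) (i : ℕ) :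
    Matrix (Fin m) (Fin m) ℝ :=
  Matrix.of fun a b => cov[fun y => M.innovation i y a, fun y => M.innovation i y b; μ]

/-- `R_e = σ² I + P`. -/
def Re (P : Matrix (Fin m) (Fin m) ℝ) : Matrix (Fin m) (Fin m) ℝ :=
  M.σ ^ 2 • (1 : Matrix (Fin m) (Fin m) ℝ) + P

/-- `K_p = A P R_e⁻¹`. -/
def Kp (P : Matrix (Fin m) (Fin m) ℝ) : Matrix (Fin m) (Fin m) ℝ :=
  M.A * P * (M.Re P)⁻¹

/-- `P` is a stabilizing solution of the discrete-time algebraic Riccati equation: a symmetric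
solution for which `A - K_p` is stable. -/
structure IsStabilizingSolution (P : Matrix (Fin m) (Fin m) ℝ) : Prop where
  symm : P.IsSymm
  isUnit_det : IsUnit (M.Re P).det
  riccati : P = M.A * P * M.A.transpose + M.B * M.Q * M.B.transpose
    - M.A * P * (M.Re P)⁻¹ * P * M.A.transpose
  stable : IsStableMatrix (M.A - M.Kp P)

/-- `P'` is a positive semidefinite solution of the Lyapunov equation
`P' = (A - K_p) P' (A - K_p)ᵀ + K_p K_pᵀ`. -/
structure IsLyapunovSolution (P P' : Matrix (Fin m) (Fin m) ℝ) : Prop where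
  posSemidef : P'.PosSemidef
  lyapunov : P' = (M.A - M.Kp P) * P' * (M.A - M.Kp P).transpose + M.Kp P * (M.Kp P).transpose

/-- `R̃_e = σ² (I + P')`. -/
def ReTilde (P' : Matrix (Fin m) (Fin m) ℝ) : Matrix (Fin m) (Fin m) ℝ :=
  M.σ ^ 2 • ((1 : Matrix (Fin m) (Fin m) ℝ) + P')

/-- `K_v = -½ log (σ^{2m} / det R_e) + ½ tr (R_e⁻¹ R̃_e) - m/2`. -/
def errorExponent (P P' : Matrix (Fin m) (Fin m) ℝ) : ℝ :=
  -(1 / 2) * Real.log (M.σ ^ (2 * m) / (M.Re P).det)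
    + 1 / 2 * ((M.Re P)⁻¹ * M.ReTilde P').trace - (m : ℝ) / 2

end VectorModel

end

noncomputable section

/-! ### Powers and perturbations of stable matrices -/

/-! Let `L` be the logarithm of the density of the law under H₀ relative to the law under H₁ for `N`
observations. By Stein's lemma (`stein_lemma`) the best miss exponent at any level is the limit in
probability of `L / N` under H₀, so a law of large numbers for `L` is what must be proved.

The likelihood ratio becomes explicit through the Kalman filter. Under H₁ the observations have the
law of a causal, causally invertible linear image of standard white noise (`lawH1_eq_map_stdNoise`),
with diagonal blocks the square roots of `σ² I + P_i`, where the `P_i` are the Riccati iterates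
started at `C₀`. Both laws are compared by characteristic functions: solving the adjoint recursion
backwards and completing the square in each Riccati step turns one covariance form into the other
(`sum_norm_sq_eq`). Hence the Kalman predictor is the conditional mean, the innovations under H₁
have covariance `σ² I + P_i`, and `L` is a sum over time of log-determinants and squared whitened
innovations, minus the squared normalized observations.

Mean of `L` under H₀: the predictor is then driven by white noise, so its covariance obeys a
Lyapunov recursion with convergent coefficients. The increments of the mean converge to `K_v`, and
so do their Cesàro averages. Fluctuations: adding an independent signal to the noise only increases
the covariance, so the normalized whitening filter is a contraction (`norm_synthesisEquiv_symm_le`).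
Thus `L` is a constant plus a quadratic form in `N m` standard Gaussians with eigenvalues in `[-1/2,
0]`; its variance is of order `N`, and Chebyshev's inequality applies.

For the Riccati equation, the iterates decrease from the stationary covariance `C₀`, so they
converge to a positive semidefinite fixed point, and stability of `A` makes the closed loop `A -
K_p` stable (`isStableMatrix_sub_Kp`). Uniqueness, solvability of the Lyapunov equation and
convergence of perturbed recursions all come from the decay of the powers of `Y ↦ F Y Gᵀ` for stable
`F`, `G`. -/

theorem tendsto_zero_of_le_mul_add {a ρ e : ℕ → ℝ} {r : ℝ} (ha : ∀ i, 0 ≤ a i)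
    (h : ∀ i, a (i + 1) ≤ ρ i * a i + e i) (hρ : Tendsto ρ atTop (𝓝 r)) (hr : r < 1)
    (he : Tendsto e atTop (𝓝 0)) : Tendsto a atTop (𝓝 0) := by
  obtain ⟨q, hq, hq1⟩ := exists_between (max_lt hr (zero_lt_one' ℝ))
  have hq0 : 0 < q := (le_max_right _ _).trans_lt hq
  rw [Metric.tendsto_atTop]
  intro ε hε
  have h1 := hρ.eventually_lt_const ((le_max_left _ _).trans_lt hq)
  have h2 := he.eventually_lt_const (show 0 < ε / 2 * (1 - q) by
    have : 0 < 1 - q := by linarith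
    positivity)
  obtain ⟨N, hN⟩ := eventually_atTop.1 (h1.and h2)
  -- The forcing is eventually below `ε / 2 * (1 - q)`, chosen so that `ε / 2` is the fixed point of
  -- `x ↦ q x + ε / 2 * (1 - q)`.
  have key : ∀ k, a (N + k) ≤ q ^ k * a N + ε / 2 := by
    intro k
    induction k with
    | zero => simp; linarith
    | succ k ih =>
      obtain ⟨h3, h4⟩ := hN (N + k) (by omega)
      calc a (N + (k + 1)) ≤ ρ (N + k) * a (N + k) + e (N + k) := h (N + k)
        _ ≤ q * a (N + k) + ε / 2 * (1 - q) := by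
            gcongr
            exact ha _
        _ ≤ q * (q ^ k * a N + ε / 2) + ε / 2 * (1 - q) := by gcongr
        _ = q ^ (k + 1) * a N + ε / 2 := by ring
  have h5 : Tendsto (fun k => q ^ k * a N) atTop (𝓝 0) := by
    simpa using (tendsto_pow_atTop_nhds_zero_of_lt_one hq0.le hq1).mul_const (a N)
  obtain ⟨k₀, hk₀⟩ := eventually_atTop.1 (h5.eventually_lt_const (half_pos hε))
  refine ⟨N + k₀, fun n hn => ?_⟩
  obtain ⟨k, rfl⟩ := Nat.exists_eq_add_of_le (show N ≤ n by omega)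
  rw [Real.dist_0_eq_abs, abs_of_nonneg (ha _)]
  linarith [key k, hk₀ k (by omega)]

/-- A linear recursion whose coefficients converge to an operator with a contracting power, and
whose forcing terms vanish in the limit, tends to zero. -/
theorem tendsto_zero_of_linear_recursion {X : Type*} [NormedAddCommGroup X] [NormedSpace ℝ X]
    {T : X →L[ℝ] X} {n : ℕ} (hn : n ≠ 0) (hT : ‖T ^ n‖ < 1) {T' : ℕ → X →L[ℝ] X}
    (hT' : Tendsto T' atTop (𝓝 T)) {x e : ℕ → X} (hx : ∀ i, x (i + 1) = T' i (x i) + e i)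
    (he : Tendsto e atTop (𝓝 0)) : Tendsto x atTop (𝓝 0) := by
  obtain ⟨s, hs, hs1⟩ := exists_between hT
  have hs0 : 0 < s := (norm_nonneg _).trans_lt hs
  set r : ℝ := s ^ ((n : ℝ)⁻¹) with hr
  have hr0 : 0 < r := Real.rpow_pos_of_pos hs0 _
  have hrn : r ^ n = s := Real.rpow_inv_natCast_pow hs0.le hn
  have hr1 : r < 1 := by
    by_contra! hc
    have := one_le_pow₀ hc (n := n)
    linarith
  set V : X → ℝ := fun x => ∑ k ∈ Finset.range n, r⁻¹ ^ k * ‖(T ^ k) x‖ with hV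
  have hV_add : ∀ x y, V (x + y) ≤ V x + V y := fun x y => by
    simp only [hV, ← Finset.sum_add_distrib, ← mul_add, map_add]
    gcongr with k
    exact norm_add_le _ _
  have hV_le : ∀ x, ‖x‖ ≤ V x := fun x => by
    have := Finset.single_le_sum (f := fun k => r⁻¹ ^ k * ‖(T ^ k) x‖) (s := Finset.range n)
      (fun k _ => by positivity) (Finset.mem_range.2 (Nat.pos_of_ne_zero hn))
    simpa [hV] using this
  set C : ℝ := ∑ k ∈ Finset.range n, r⁻¹ ^ k * ‖T ^ k‖ with hC
  have hVC : ∀ x, V x ≤ C * ‖x‖ := fun x => by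
    simp only [hV, hC, Finset.sum_mul, mul_assoc]
    gcongr with k
    exact (T ^ k).le_opNorm x
  have hC0 : 0 ≤ C := Finset.sum_nonneg fun k _ => by positivity
  have hVT : ∀ x, V (T x) ≤ r * V x := fun x => by
    have h1 : V (T x) = r * ∑ k ∈ Finset.range n, r⁻¹ ^ (k + 1) * ‖(T ^ (k + 1)) x‖ := by
      simp only [hV, Finset.mul_sum]
      refine Finset.sum_congr rfl fun k _ => ?_
      rw [pow_succ r⁻¹, pow_succ T]
      field_simp
      rfl
    have h2 := Finset.sum_range_succ' (fun k => r⁻¹ ^ k * ‖(T ^ k) x‖) n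
    have h3 := Finset.sum_range_succ (fun k => r⁻¹ ^ k * ‖(T ^ k) x‖) n
    have h4 : r⁻¹ ^ n * ‖(T ^ n) x‖ ≤ ‖x‖ := by
      rw [inv_pow, hrn, inv_mul_le_iff₀ hs0]
      exact ((T ^ n).le_opNorm x).trans (by gcongr)
    rw [h1]
    gcongr
    have h5 : r⁻¹ ^ 0 * ‖(T ^ 0) x‖ = ‖x‖ := by simp
    simp only [hV]
    linarith
  have hVx : Tendsto (fun i => V (x i)) atTop (𝓝 0) := by
    refine tendsto_zero_of_le_mul_add (ρ := fun i => r + C * ‖T' i - T‖)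
      (e := fun i => C * ‖e i‖) (r := r) (fun i => (norm_nonneg _).trans (hV_le _))
      (fun i => ?_) ?_ hr1 ?_
    · have h1 : x (i + 1) = T (x i) + (T' i - T) (x i) + e i := by simp [hx i]
      calc V (x (i + 1)) ≤ V (T (x i)) + V ((T' i - T) (x i)) + V (e i) := by
            rw [h1]
            exact (hV_add _ _).trans (by gcongr; exact hV_add _ _)
        _ ≤ r * V (x i) + C * (‖T' i - T‖ * V (x i)) + C * ‖e i‖ := by
            gcongr
            · exact hVT _
            · refine (hVC _).trans ?_
              gcongr
              exact ((T' i - T).le_opNorm _).trans (by gcongr; exact hV_le _)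
            · exact hVC _
        _ = _ := by ring
    · simpa using (tendsto_iff_norm_sub_tendsto_zero.1 hT').const_mul C |>.const_add r
    · simpa using he.norm.const_mul C
  exact squeeze_zero_norm (fun i => hV_le _) hVx

/-- Gelfand's formula: `‖a ^ n‖ ^ (1 / n)` is eventually below some `r < 1`. -/
theorem tendsto_pow_zero_of_spectralRadius_lt_one {A : Type*} [NormedRing A] [NormedAlgebra ℂ A]
    [CompleteSpace A] {a : A} (ha : spectralRadius ℂ a < 1) :
    Tendsto (fun n : ℕ => a ^ n) atTop (𝓝 0) := by
  obtain ⟨r, hr, hr1⟩ := ENNReal.lt_iff_exists_nnreal_btwn.1 ha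
  have h := (spectrum.pow_nnnorm_pow_one_div_tendsto_nhds_spectralRadius a).eventually_lt_const hr
  have hr1' : (r : ℝ) < 1 := by exact_mod_cast hr1
  refine squeeze_zero_norm' ?_ (tendsto_pow_atTop_nhds_zero_of_lt_one r.2 hr1')
  filter_upwards [h, eventually_gt_atTop 0] with n hn hn0
  have h1 := ENNReal.rpow_le_rpow hn.le (show (0 : ℝ) ≤ n by positivity)
  rw [← ENNReal.rpow_mul, one_div, inv_mul_cancel₀ (by positivity), ENNReal.rpow_one,
    ENNReal.rpow_natCast] at h1
  exact_mod_cast h1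

/-- The error `S - X` obeys a linear recursion with operator `Y ↦ F' Y G'` and vanishing forcing.
The limiting operator has `n`-th power `Y ↦ F ^ n Y G ^ n`, which is a contraction for some `n`. -/
theorem tendsto_of_stein_recursion {R : Type*} [NormedRing R] [NormedAlgebra ℝ R] {F G X N : R}
    (hF : Tendsto (fun n : ℕ => F ^ n) atTop (𝓝 0)) (hG : Tendsto (fun n : ℕ => G ^ n) atTop (𝓝 0))
    (hX : X = F * X * G + N) {F' G' N' S : ℕ → R} (hF' : Tendsto F' atTop (𝓝 F))
    (hG' : Tendsto G' atTop (𝓝 G)) (hN' : Tendsto N' atTop (𝓝 N))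
    (hS : ∀ i, S (i + 1) = F' i * S i * G' i + N' i) : Tendsto S atTop (𝓝 X) := by
  have he := (((hF'.mul_const X).mul hG').add hN').sub_const X
  rw [← hX, sub_self] at he
  obtain ⟨T, hT, hTnorm⟩ : ∃ T : R →L[ℝ] R →L[ℝ] R →L[ℝ] R,
      (∀ x y z, T x y z = x * z * y) ∧ ∀ x y, ‖T x y‖ ≤ ‖x‖ * ‖y‖ :=
    ⟨ContinuousLinearMap.mulLeftRight ℝ R, fun x y z => rfl,
      ContinuousLinearMap.opNorm_mulLeftRight_apply_apply_le ℝ R⟩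
  have hpow : ∀ n : ℕ, (T F G) ^ n = T (F ^ n) (G ^ n) := by
    intro n
    ext1 Y
    induction n with
    | zero => simp [hT]
    | succ n ih =>
      rw [pow_succ', mul_apply_eq_comp, ih, hT, hT, hT, pow_succ' F, pow_succ G]
      simp only [mul_assoc]
  have hlim : Tendsto (fun n : ℕ => ‖F ^ n‖ * ‖G ^ n‖) atTop (𝓝 0) := by
    simpa using hF.norm.mul hG.norm
  obtain ⟨n, hn1, hn0⟩ :=
    ((hlim.eventually_lt_const one_pos).and (eventually_ne_atTop 0)).exists
  have hTn : ‖(T F G) ^ n‖ < 1 := by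
    rw [hpow]
    exact (hTnorm _ _).trans_lt hn1
  have hT' : Tendsto (fun i => T (F' i) (G' i)) atTop (𝓝 (T F G)) :=
    (T.continuous₂.tendsto (F, G)).comp (hF'.prodMk_nhds hG')
  have key := tendsto_zero_of_linear_recursion hn0 hTn hT' (x := fun i => S i - X)
    (e := fun i => F' i * X * G' i + N' i - X) (fun i => ?_) he
  · exact tendsto_sub_nhds_zero_iff.1 key
  · simp only [hT, hS]
    noncomm_ring

section StableMatrix

variable {m : ℕ}

theorem IsStableMatrix.tendsto_pow {F : Matrix (Fin m) (Fin m) ℝ} (hF : IsStableMatrix F) :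
    Tendsto (fun n : ℕ => F ^ n) atTop (𝓝 0) := by
  rcases isEmpty_or_nonempty (Fin m) with hm | hm
  · exact tendsto_const_nhds.congr fun n => Subsingleton.elim _ _
  let _ := Matrix.linftyOpNormedRing (n := Fin m) (α := ℂ)
  let _ := Matrix.linftyOpNormedAlgebra (R := ℂ) (n := Fin m) (α := ℂ)
  have h1 : spectralRadius ℂ (F.map (algebraMap ℝ ℂ)) < 1 := by
    refine spectrum.spectralRadius_lt_of_forall_lt _ (r := 1) fun z hz => ?_
    exact_mod_cast hF z hz
  have h2 := tendsto_pow_zero_of_spectralRadius_lt_one h1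
  refine tendsto_pi_nhds.2 fun i => tendsto_pi_nhds.2 fun j => ?_
  have h3 := (Complex.continuous_re.tendsto _).comp (tendsto_pi_nhds.1 (tendsto_pi_nhds.1 h2 i) j)
  refine (h3.congr fun n => ?_)
  have : (F.map (algebraMap ℝ ℂ)) ^ n = (F ^ n).map (algebraMap ℝ ℂ) := by
    rw [← RingHom.mapMatrix_apply, ← map_pow]; rfl
  rw [Function.comp_apply, this]
  simp

theorem IsStableMatrix.transpose {F : Matrix (Fin m) (Fin m) ℝ} (hF : IsStableMatrix F) :
    IsStableMatrix F.transpose := by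
  intro z hz
  refine hF z ?_
  rw [spectrum.mem_iff] at hz ⊢
  rwa [← Matrix.isUnit_transpose, Matrix.transpose_sub, Matrix.algebraMap_eq_diagonal,
    Matrix.diagonal_transpose, ← Matrix.algebraMap_eq_diagonal]

/-- The Stein equation `X = F X Gᵀ` with stable `F` and `G` has only the zero solution. -/
theorem IsStableMatrix.eq_zero_of_eq_mul_mul {F G X : Matrix (Fin m) (Fin m) ℝ}
    (hF : IsStableMatrix F) (hG : IsStableMatrix G) (h : X = F * X * G.transpose) : X = 0 := by
  have h1 : ∀ n : ℕ, X = F ^ n * X * G.transpose ^ n := by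
    intro n
    induction n with
    | zero => simp
    | succ n ih =>
      calc X = F ^ n * X * G.transpose ^ n := ih
        _ = F ^ n * (F * X * G.transpose) * G.transpose ^ n := by rw [← h]
        _ = F ^ (n + 1) * X * G.transpose ^ (n + 1) := by
          rw [pow_succ, pow_succ']; simp only [mul_assoc]
  have h2 : Tendsto (fun n : ℕ => F ^ n * X * G.transpose ^ n) atTop (𝓝 (0 * X * 0)) :=
    (hF.tendsto_pow.mul_const X).mul hG.transpose.tendsto_pow
  rw [mul_zero] at h2
  exact tendsto_nhds_unique (tendsto_const_nhds.congr h1) h2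

/-- On a finite-dimensional space, injectivity of `X ↦ X - F X Fᵀ` gives surjectivity. -/
theorem IsStableMatrix.exists_lyapunov {F : Matrix (Fin m) (Fin m) ℝ} (hF : IsStableMatrix F)
    (N : Matrix (Fin m) (Fin m) ℝ) : ∃ X, X = F * X * F.transpose + N := by
  set T : Matrix (Fin m) (Fin m) ℝ →ₗ[ℝ] Matrix (Fin m) (Fin m) ℝ :=
    LinearMap.id - (LinearMap.mulLeft ℝ F).comp (LinearMap.mulRight ℝ F.transpose) with hT
  have hTX : ∀ X, T X = X - F * X * F.transpose := fun X => by simp [hT, mul_assoc]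
  have hinj : Function.Injective T := by
    rw [← LinearMap.ker_eq_bot, LinearMap.ker_eq_bot']
    intro X hX
    rw [hTX, sub_eq_zero] at hX
    exact hF.eq_zero_of_eq_mul_mul hF hX
  obtain ⟨X, hX⟩ := LinearMap.injective_iff_surjective.1 hinj N
  exact ⟨X, by rw [← hX, hTX]; abel⟩

/-- The solution of a perturbed Lyapunov recursion converges to that of the limiting equation. -/
theorem IsStableMatrix.tendsto_lyapunov {F X : Matrix (Fin m) (Fin m) ℝ} (hF : IsStableMatrix F)
    {N : Matrix (Fin m) (Fin m) ℝ} (hX : X = F * X * F.transpose + N)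
    {F' N' S : ℕ → Matrix (Fin m) (Fin m) ℝ} (hF' : Tendsto F' atTop (𝓝 F))
    (hN' : Tendsto N' atTop (𝓝 N))
    (hS : ∀ i, S (i + 1) = F' i * S i * (F' i).transpose + N' i) :
    Tendsto S atTop (𝓝 X) := by
  have hFt : Tendsto (fun i => (F' i).transpose) atTop (𝓝 F.transpose) :=
    (continuous_id.matrix_transpose.tendsto _).comp hF'
  -- The row-sum operator norm makes matrices a normed algebra; it only serves to prove a statement
  -- about entrywise convergence.
  exact @tendsto_of_stein_recursion _ Matrix.linftyOpNormedRing Matrix.linftyOpNormedAlgebra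
    _ _ _ _ hF.tendsto_pow hF.transpose.tendsto_pow hX _ _ _ _ hF' hFt hN' hS

/-- `X` and its transpose solve the same equation, whose solution is unique, so `X` is symmetric. It
is nonnegative as the limit of the iterates of `Y ↦ F Y Fᵀ + N` from zero, each of which is positive
semidefinite. -/
theorem IsStableMatrix.posSemidef_of_lyapunov {F X N : Matrix (Fin m) (Fin m) ℝ}
    (hF : IsStableMatrix F) (hN : N.PosSemidef) (hX : X = F * X * F.transpose + N) :
    X.PosSemidef := by
  have hsymm : X.IsHermitian := by
    refine sub_eq_zero.1 (hF.eq_zero_of_eq_mul_mul hF ?_)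
    have h1 := congrArg Matrix.transpose hX
    have h2 : N.transpose = N := by simpa using hN.1.eq
    simp only [Matrix.transpose_add, Matrix.transpose_mul, Matrix.transpose_transpose, h2] at h1
    rw [Matrix.conjTranspose_eq_transpose_of_trivial]
    calc X.transpose - X = F * (X.transpose * F.transpose) + N - (F * X * F.transpose + N) := by
          rw [← h1, ← hX]
      _ = _ := by noncomm_ring
  refine .of_dotProduct_mulVec_nonneg hsymm fun x => ?_
  let S : ℕ → Matrix (Fin m) (Fin m) ℝ := fun n => (fun Y => F * Y * F.transpose + N)^[n] 0
  have hS : ∀ n, (S n).PosSemidef := by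
    intro n
    induction n with
    | zero => exact Matrix.PosSemidef.zero
    | succ n ih =>
      simp only [S, Function.iterate_succ_apply']
      have := (ih.mul_mul_conjTranspose_same F).add hN
      rwa [Matrix.conjTranspose_eq_transpose_of_trivial] at this
  have hlim : Tendsto S atTop (𝓝 X) :=
    hF.tendsto_lyapunov hX tendsto_const_nhds tendsto_const_nhds fun i => by
      simp only [S, Function.iterate_succ_apply']
  have hcont : Continuous fun Y : Matrix (Fin m) (Fin m) ℝ => star x ⬝ᵥ Y.mulVec x := by
    fun_prop
  exact ge_of_tendsto' ((hcont.tendsto _).comp hlim) fun n =>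
    (hS n).dotProduct_mulVec_nonneg x

end StableMatrix

/-! ### The Riccati recursion -/

section PosSemidefSequence

variable {m : ℕ}

/-- A decreasing sequence of positive semidefinite matrices converges. -/
theorem Matrix.PosSemidef.exists_tendsto_of_antitone {P : ℕ → Matrix (Fin m) (Fin m) ℝ}
    (hP : ∀ i, (P i).PosSemidef) (hanti : ∀ i, (P i - P (i + 1)).PosSemidef) :
    ∃ X : Matrix (Fin m) (Fin m) ℝ, Tendsto P atTop (𝓝 X) ∧ X.PosSemidef := by
  have hq : ∀ x : Fin m → ℝ, ∃ l, Tendsto (fun i => x ⬝ᵥ (P i).mulVec x) atTop (𝓝 l) := by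
    intro x
    refine ⟨_, tendsto_atTop_ciInf (antitone_nat_of_succ_le fun i => ?_) ⟨0, ?_⟩⟩
    · have := (hanti i).dotProduct_mulVec_nonneg x
      simpa [Matrix.sub_mulVec, dotProduct_sub] using this
    · rintro _ ⟨i, rfl⟩
      simpa using (hP i).dotProduct_mulVec_nonneg x
  choose l hl using hq
  -- Polarization recovers the entries from the values of the quadratic form, which converge by
  -- monotonicity.
  have hentry : ∀ a b i, P i a b = (((Pi.single a 1 + Pi.single b 1 : Fin m → ℝ) ⬝ᵥ
      (P i).mulVec (Pi.single a 1 + Pi.single b 1)) - (Pi.single a 1 : Fin m → ℝ) ⬝ᵥ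
      (P i).mulVec (Pi.single a 1) - (Pi.single b 1 : Fin m → ℝ) ⬝ᵥ
      (P i).mulVec (Pi.single b 1)) / 2 := by
    intro a b i
    have hs : P i b a = P i a b := by simpa using (hP i).1.apply a b
    simp only [Matrix.mulVec_add, dotProduct_add, add_dotProduct, Matrix.mulVec_single_one,
      single_one_dotProduct, Matrix.col_apply, hs]
    ring
  set X : Matrix (Fin m) (Fin m) ℝ := Matrix.of fun a b =>
    (l (Pi.single a 1 + Pi.single b 1) - l (Pi.single a 1) - l (Pi.single b 1)) / 2
  have hlim : Tendsto P atTop (𝓝 X) :=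
    tendsto_pi_nhds.2 fun a => tendsto_pi_nhds.2 fun b =>
      ((((hl _).sub (hl _)).sub (hl _)).div_const 2).congr fun i => (hentry a b i).symm
  refine ⟨X, hlim, .of_dotProduct_mulVec_nonneg ?_ fun x => ?_⟩
  · have h1 : Tendsto (fun i => (P i).conjTranspose) atTop (𝓝 X.conjTranspose) :=
      (continuous_id.matrix_conjTranspose.tendsto _).comp hlim
    exact tendsto_nhds_unique h1 (hlim.congr fun i => (hP i).1.symm)
  · have hcont : Continuous fun Y : Matrix (Fin m) (Fin m) ℝ => star x ⬝ᵥ Y.mulVec x := by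
      fun_prop
    exact ge_of_tendsto' ((hcont.tendsto _).comp hlim) fun n =>
      (hP n).dotProduct_mulVec_nonneg x

/-- Matrix inversion is antitone on positive definite matrices. -/
theorem Matrix.PosDef.posSemidef_inv_sub_inv {R S : Matrix (Fin m) (Fin m) ℝ} (hR : R.PosDef)
    (hS : S.PosDef) (h : (S - R).PosSemidef) : (R⁻¹ - S⁻¹).PosSemidef := by
  have hR' : IsUnit R.det := (Matrix.isUnit_iff_isUnit_det _).1 hR.isUnit
  have hS' : IsUnit S.det := (Matrix.isUnit_iff_isUnit_det _).1 hS.isUnit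
  -- With `D = S - R`, the difference of inverses is a congruence of `D + D R⁻¹ D`, a sum of two
  -- positive semidefinite matrices.
  have hid : R⁻¹ - S⁻¹ = S⁻¹ * ((S - R) + (S - R) * R⁻¹ * (S - R)) * S⁻¹ := by
    have h1 : (S - R) + (S - R) * R⁻¹ * (S - R) = S * R⁻¹ * S - S := by
      have e1 : R⁻¹ * R = 1 := Matrix.nonsing_inv_mul _ hR'
      have e2 : R * R⁻¹ = 1 := Matrix.mul_nonsing_inv _ hR'
      calc (S - R) + (S - R) * R⁻¹ * (S - R)
          = S - R + (S * R⁻¹ * S - S * (R⁻¹ * R) - R * R⁻¹ * S + R * R⁻¹ * R) := by noncomm_ring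
        _ = S * R⁻¹ * S - S := by rw [e1, e2]; noncomm_ring
    have e3 : S⁻¹ * S = 1 := Matrix.nonsing_inv_mul _ hS'
    have e4 : S * S⁻¹ = 1 := Matrix.mul_nonsing_inv _ hS'
    rw [h1]
    calc R⁻¹ - S⁻¹ = 1 * R⁻¹ * 1 - 1 * S⁻¹ := by noncomm_ring
      _ = (S⁻¹ * S) * R⁻¹ * (S * S⁻¹) - S⁻¹ * S * S⁻¹ := by rw [e3, e4]
      _ = _ := by noncomm_ring
  have hmid := h.add (hR.inv.posSemidef.mul_mul_conjTranspose_same (S - R))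
  rw [h.1.eq] at hmid
  have := hmid.mul_mul_conjTranspose_same S⁻¹
  rwa [hS.inv.1.eq, ← hid] at this

end PosSemidefSequence

/-! ### The Riccati equation: monotone convergence, stability of the closed loop, uniqueness. -/

namespace VectorModel

variable {m p : ℕ} (M : VectorModel m p)

/-- One step of the Riccati recursion for the prediction error covariance. -/
def riccatiStep (P : Matrix (Fin m) (Fin m) ℝ) : Matrix (Fin m) (Fin m) ℝ :=
  M.A * P * M.A.transpose + M.B * M.Q * M.B.transpose
    - M.A * P * (M.Re P)⁻¹ * P * M.A.transpose

/-- The prediction error covariances of the Kalman filter started from the stationary law. -/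
def riccatiSeq : ℕ → Matrix (Fin m) (Fin m) ℝ
  | 0 => M.C₀
  | i + 1 => M.riccatiStep (riccatiSeq i)

variable {M} {P X : Matrix (Fin m) (Fin m) ℝ}

theorem posDef_Re (hσ : 0 < M.σ) (hP : P.PosSemidef) : (M.Re P).PosDef :=
  (Matrix.PosDef.one.smul (pow_pos hσ 2)).add_posSemidef hP

theorem isUnit_det_Re (hσ : 0 < M.σ) (hP : P.PosSemidef) : IsUnit (M.Re P).det :=
  (Matrix.isUnit_iff_isUnit_det _).1 (posDef_Re hσ hP).isUnit

theorem mul_inv_Re (h : IsUnit (M.Re P).det) :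
    P * (M.Re P)⁻¹ = 1 - M.σ ^ 2 • (M.Re P)⁻¹ := by
  have h1 : M.Re P * (M.Re P)⁻¹ = 1 := Matrix.mul_nonsing_inv _ h
  nth_rw 1 [Re] at h1
  rw [add_mul, smul_mul_assoc, one_mul] at h1
  exact eq_sub_of_add_eq' h1

theorem inv_Re_mul (h : IsUnit (M.Re P).det) :
    (M.Re P)⁻¹ * P = 1 - M.σ ^ 2 • (M.Re P)⁻¹ := by
  have h1 : (M.Re P)⁻¹ * M.Re P = 1 := Matrix.nonsing_inv_mul _ h
  nth_rw 2 [Re] at h1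
  rw [mul_add, mul_smul_comm, mul_one] at h1
  exact eq_sub_of_add_eq' h1

theorem transpose_inv_Re (hP : P.IsSymm) : ((M.Re P)⁻¹).transpose = (M.Re P)⁻¹ := by
  rw [Matrix.transpose_nonsing_inv]
  simp [Re, hP.eq]

theorem sub_Kp_eq (h : IsUnit (M.Re P).det) :
    M.A - M.Kp P = M.σ ^ 2 • (M.A * (M.Re P)⁻¹) := by
  rw [Kp, mul_assoc, mul_inv_Re h, mul_sub, mul_one, mul_smul_comm, sub_sub_cancel]

/-- Substituting `P = R_e - σ² I` leaves `P` only inside `R_e⁻¹`, the form suited to monotonicity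
and to differences. -/
theorem riccatiStep_eq (h : IsUnit (M.Re P).det) :
    M.riccatiStep P = M.B * M.Q * M.B.transpose + M.σ ^ 2 • (M.A * M.A.transpose)
      - M.σ ^ 4 • (M.A * (M.Re P)⁻¹ * M.A.transpose) := by
  have h1 : P * (M.Re P)⁻¹ * P = P - M.σ ^ 2 • 1 + M.σ ^ 4 • (M.Re P)⁻¹ := by
    rw [mul_inv_Re h, sub_mul, smul_mul_assoc, inv_Re_mul h, smul_sub, smul_smul, one_mul]
    rw [show M.σ ^ 4 = M.σ ^ 2 * M.σ ^ 2 by ring]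
    abel
  have h2 : M.A * P * (M.Re P)⁻¹ * P * M.A.transpose
      = M.A * (P * (M.Re P)⁻¹ * P) * M.A.transpose := by simp only [mul_assoc]
  rw [riccatiStep, h2, h1]
  simp only [mul_add, add_mul, mul_sub, sub_mul, mul_smul_comm, smul_mul_assoc, mul_one]
  abel

/-- The resolvent identity for `R_e⁻¹`, together with `A - K_p = σ² A R_e⁻¹`, produces a different
closed-loop matrix on each side. Two fixed points thus differ by a solution of a homogeneous Stein
equation. -/
theorem riccatiStep_sub (hP : IsUnit (M.Re P).det) (hX : IsUnit (M.Re X).det) (hXs : X.IsSymm) :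
    M.riccatiStep P - M.riccatiStep X
      = (M.A - M.Kp P) * (P - X) * (M.A - M.Kp X).transpose := by
  have h1 : (M.Re X)⁻¹ - (M.Re P)⁻¹ = (M.Re P)⁻¹ * (P - X) * (M.Re X)⁻¹ := by
    have e : P - X = M.Re P - M.Re X := by simp [Re]
    rw [e, mul_sub, sub_mul, Matrix.nonsing_inv_mul _ hP, one_mul, mul_assoc,
      Matrix.mul_nonsing_inv _ hX, mul_one]
  have h2 : (M.A - M.Kp X).transpose = M.σ ^ 2 • ((M.Re X)⁻¹ * M.A.transpose) := by
    rw [sub_Kp_eq hX, Matrix.transpose_smul, Matrix.transpose_mul, transpose_inv_Re hXs]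
  have h3 : M.riccatiStep P - M.riccatiStep X
      = M.σ ^ 4 • (M.A * ((M.Re X)⁻¹ - (M.Re P)⁻¹) * M.A.transpose) := by
    rw [riccatiStep_eq hP, riccatiStep_eq hX, mul_sub, sub_mul, smul_sub]
    abel
  rw [h3, h1, sub_Kp_eq hP, h2]
  simp only [smul_mul_assoc, mul_smul_comm, smul_smul, mul_assoc]
  congr 1
  ring

/-- The Joseph form: a sum of congruences, hence visibly positive semidefinite, and at a fixed point
a Lyapunov equation for `P` with the closed-loop matrix. -/
theorem riccatiStep_eq_joseph (h : IsUnit (M.Re P).det) (hP : P.IsSymm) :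
    M.riccatiStep P = (M.A - M.Kp P) * P * (M.A - M.Kp P).transpose
      + M.B * M.Q * M.B.transpose + M.σ ^ 2 • (M.Kp P * (M.Kp P).transpose) := by
  have hPt : P.transpose = P := hP
  have h1 : (M.A - M.Kp P).transpose = M.σ ^ 2 • ((M.Re P)⁻¹ * M.A.transpose) := by
    rw [sub_Kp_eq h, Matrix.transpose_smul, Matrix.transpose_mul, transpose_inv_Re hP]
  have h2 : M.Kp P = M.A - M.σ ^ 2 • (M.A * (M.Re P)⁻¹) := by rw [← sub_Kp_eq h]; abel
  have h3 : (M.Kp P).transpose = M.A.transpose - M.σ ^ 2 • ((M.Re P)⁻¹ * M.A.transpose) := by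
    rw [← h1, Matrix.transpose_sub]; abel
  have h4 : M.σ ^ 2 • (M.A * (M.Re P)⁻¹) * P = M.σ ^ 2 • M.A
      - M.σ ^ 4 • (M.A * (M.Re P)⁻¹) := by
    rw [smul_mul_assoc, mul_assoc, inv_Re_mul h, mul_sub, mul_one, smul_sub, mul_smul_comm,
      smul_smul]
    congr 2
    ring
  rw [riccatiStep_eq h, h1, h3, h2, sub_sub_cancel, h4]
  simp only [mul_sub, sub_mul, mul_smul_comm, smul_mul_assoc, smul_sub, smul_smul, mul_assoc]
  module

theorem posSemidef_riccatiStep (hσ : 0 < M.σ) (hQ : M.Q.PosSemidef) (hP : P.PosSemidef) :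
    (M.riccatiStep P).PosSemidef := by
  have hs : P.IsSymm := by simpa [Matrix.IsSymm] using hP.1.eq
  rw [riccatiStep_eq_joseph (isUnit_det_Re hσ hP) hs]
  have h1 := hP.mul_mul_conjTranspose_same (M.A - M.Kp P)
  have h2 := hQ.mul_mul_conjTranspose_same M.B
  have h3 := (Matrix.posSemidef_self_mul_conjTranspose (M.Kp P)).smul (sq_nonneg M.σ)
  simp only [Matrix.conjTranspose_eq_transpose_of_trivial] at h1 h2 h3
  exact (h1.add h2).add h3

theorem riccatiStep_mono (hσ : 0 < M.σ) (hP : P.PosSemidef) (hX : X.PosSemidef)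
    (h : (P - X).PosSemidef) : (M.riccatiStep P - M.riccatiStep X).PosSemidef := by
  have h1 : ((M.Re X)⁻¹ - (M.Re P)⁻¹).PosSemidef :=
    (posDef_Re hσ hX).posSemidef_inv_sub_inv (posDef_Re hσ hP) (by simpa [Re] using h)
  have h2 := (h1.mul_mul_conjTranspose_same M.A).smul (show 0 ≤ M.σ ^ 4 by positivity)
  rw [Matrix.conjTranspose_eq_transpose_of_trivial] at h2
  rw [riccatiStep_eq (isUnit_det_Re hσ hP), riccatiStep_eq (isUnit_det_Re hσ hX)]
  convert h2 using 1
  rw [mul_sub, sub_mul, smul_sub]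
  abel

theorem posSemidef_riccatiSeq (hσ : 0 < M.σ) (hQ : M.Q.PosSemidef) (hC₀ : M.C₀.PosSemidef) :
    ∀ i, (M.riccatiSeq i).PosSemidef
  | 0 => hC₀
  | i + 1 => posSemidef_riccatiStep hσ hQ (posSemidef_riccatiSeq hσ hQ hC₀ i)

/-- Stationarity of `C₀` cancels the first two terms of the first step, leaving a decrease by the
positive semidefinite correction. Monotonicity of the step propagates this ordering. -/
theorem riccatiSeq_antitone (hσ : 0 < M.σ) (hQ : M.Q.PosSemidef) (hC₀ : M.C₀.PosSemidef)
    (hstat : M.C₀ = M.A * M.C₀ * M.A.transpose + M.B * M.Q * M.B.transpose) :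
    ∀ i, (M.riccatiSeq i - M.riccatiSeq (i + 1)).PosSemidef
  | 0 => by
    have h1 := (posDef_Re hσ hC₀).inv.posSemidef.mul_mul_conjTranspose_same (M.A * M.C₀)
    have h2 : (M.A * M.C₀).conjTranspose = M.C₀ * M.A.transpose := by
      rw [Matrix.conjTranspose_mul, hC₀.1.eq, Matrix.conjTranspose_eq_transpose_of_trivial]
    rw [h2] at h1
    have h3 : M.C₀ - M.riccatiStep M.C₀
        = M.A * M.C₀ * (M.Re M.C₀)⁻¹ * (M.C₀ * M.A.transpose) := by
      rw [riccatiStep, ← hstat, sub_sub_cancel, ← mul_assoc]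
    exact h3 ▸ h1
  | i + 1 => riccatiStep_mono hσ (posSemidef_riccatiSeq hσ hQ hC₀ i)
      (posSemidef_riccatiSeq hσ hQ hC₀ (i + 1)) (riccatiSeq_antitone hσ hQ hC₀ hstat i)

theorem tendsto_inv_Re (hσ : 0 < M.σ) (hP : P.PosSemidef) {P' : ℕ → Matrix (Fin m) (Fin m) ℝ}
    (h : Tendsto P' atTop (𝓝 P)) :
    Tendsto (fun i => (M.Re (P' i))⁻¹) atTop (𝓝 (M.Re P)⁻¹) := by
  have h1 : Tendsto (fun i => M.Re (P' i)) atTop (𝓝 (M.Re P)) := h.const_add _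
  have h2 : Continuous fun Y : Matrix (Fin m) (Fin m) ℝ => Y.det := by fun_prop
  have h3 : Continuous fun Y : Matrix (Fin m) (Fin m) ℝ => Y.adjugate := by fun_prop
  simp only [Matrix.inv_def, Ring.inverse_eq_inv']
  exact (((h2.tendsto _).comp h1).inv₀ (isUnit_det_Re hσ hP).ne_zero).smul
    ((h3.tendsto _).comp h1)

theorem tendsto_Kp (hσ : 0 < M.σ) (hP : P.PosSemidef) {P' : ℕ → Matrix (Fin m) (Fin m) ℝ}
    (h : Tendsto P' atTop (𝓝 P)) :
    Tendsto (fun i => M.Kp (P' i)) atTop (𝓝 (M.Kp P)) :=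
  (h.const_mul M.A).mul (tendsto_inv_Re hσ hP h)

theorem exists_riccati_fixedPoint (hσ : 0 < M.σ) (hQ : M.Q.PosSemidef) (hC₀ : M.C₀.PosSemidef)
    (hstat : M.C₀ = M.A * M.C₀ * M.A.transpose + M.B * M.Q * M.B.transpose) :
    ∃ P, Tendsto M.riccatiSeq atTop (𝓝 P) ∧ P.PosSemidef ∧ P = M.riccatiStep P := by
  obtain ⟨P, hlim, hP⟩ := Matrix.PosSemidef.exists_tendsto_of_antitone
    (posSemidef_riccatiSeq hσ hQ hC₀) (riccatiSeq_antitone hσ hQ hC₀ hstat)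
  refine ⟨P, hlim, hP, ?_⟩
  have h1 : Tendsto (fun i => M.riccatiStep (M.riccatiSeq i)) atTop (𝓝 (M.riccatiStep P)) :=
    (((hlim.const_mul M.A).mul_const _).add_const _).sub
      ((((hlim.const_mul M.A).mul (tendsto_inv_Re hσ hP hlim)).mul hlim).mul_const _)
  exact tendsto_nhds_unique ((tendsto_add_atTop_iff_nat 1).2 hlim) h1

/-- A positive semidefinite solution of the Riccati equation is stabilizing when `A` is stable. -/
theorem isStableMatrix_sub_Kp (hσ : 0 < M.σ) (hQ : M.Q.PosSemidef) (hA : IsStableMatrix M.A)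
    (hP : P.PosSemidef) (hfix : P = M.riccatiStep P) : IsStableMatrix (M.A - M.Kp P) := by
  have hs : P.IsSymm := by simpa [Matrix.IsSymm] using hP.1.eq
  set F := M.A - M.Kp P with hF
  intro z hz
  by_contra! hz1
  have h1 : ((algebraMap ℂ (Matrix (Fin m) (Fin m) ℂ)) z - F.map (algebraMap ℝ ℂ)).det = 0 := by
    rw [spectrum.mem_iff, Matrix.isUnit_iff_isUnit_det, isUnit_iff_ne_zero, not_not] at hz
    exact hz
  -- A left eigenvector of the closed loop with `|z| ≥ 1` is split into real and imaginary parts, so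
  -- that the real quadratic forms of `P` and `Q` can be used.
  obtain ⟨v, hv0, hv⟩ := Matrix.exists_vecMul_eq_zero_iff.2 h1
  have hvF : Matrix.vecMul v (F.map (algebraMap ℝ ℂ)) = z • v := by
    rw [Matrix.vecMul_sub, sub_eq_zero, Algebra.algebraMap_eq_smul_one, Matrix.vecMul_smul,
      Matrix.vecMul_one] at hv
    exact hv.symm
  set a : Fin m → ℝ := fun i => (v i).re with ha
  set b : Fin m → ℝ := fun i => (v i).im with hb
  have hre : ∀ (N : Matrix (Fin m) (Fin m) ℝ) i,
      (Matrix.vecMul v (N.map (algebraMap ℝ ℂ)) i).re = Matrix.vecMul a N i := by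
    intro N i
    simp [Matrix.vecMul, dotProduct, a]
  have him : ∀ (N : Matrix (Fin m) (Fin m) ℝ) i,
      (Matrix.vecMul v (N.map (algebraMap ℝ ℂ)) i).im = Matrix.vecMul b N i := by
    intro N i
    simp [Matrix.vecMul, dotProduct, b]
  have haF : Matrix.vecMul a F = z.re • a - z.im • b := by
    ext i
    rw [← hre, hvF]
    simp [a, b]
  have hbF : Matrix.vecMul b F = z.im • a + z.re • b := by
    ext i
    rw [← him, hvF]
    simp [a, b]
    ring
  have hq : ∀ x : Fin m → ℝ, x ⬝ᵥ P.mulVec x = Matrix.vecMul x F ⬝ᵥ P.mulVec (Matrix.vecMul x F)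
      + Matrix.vecMul x M.B ⬝ᵥ M.Q.mulVec (Matrix.vecMul x M.B)
      + M.σ ^ 2 * (Matrix.vecMul x (M.Kp P) ⬝ᵥ Matrix.vecMul x (M.Kp P)) := by
    intro x
    nth_rw 1 [hfix]
    rw [riccatiStep_eq_joseph (isUnit_det_Re hσ hP) hs, ← hF]
    simp only [Matrix.add_mulVec, dotProduct_add, Matrix.smul_mulVec, dotProduct_smul,
      ← Matrix.mulVec_mulVec, Matrix.dotProduct_mulVec, Matrix.mulVec_transpose,
      smul_eq_mul]
  have hPab : b ⬝ᵥ P.mulVec a = a ⬝ᵥ P.mulVec b := by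
    rw [Matrix.dotProduct_mulVec, dotProduct_comm, ← Matrix.mulVec_transpose, hs.eq]
  have hqa := hq a
  have hqb := hq b
  have hQa := hQ.dotProduct_mulVec_nonneg (Matrix.vecMul a M.B)
  have hQb := hQ.dotProduct_mulVec_nonneg (Matrix.vecMul b M.B)
  have hPa := hP.dotProduct_mulVec_nonneg a
  have hPb := hP.dotProduct_mulVec_nonneg b
  simp only [star_trivial] at hQa hQb hPa hPb
  have hzz : 1 ≤ z.re ^ 2 + z.im ^ 2 := by
    have := Complex.sq_norm z
    rw [Complex.normSq_apply] at this
    nlinarith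
  -- Summed over both parts, the form of `P` is multiplied by `|z|² ≥ 1`. The Joseph identity `hq`
  -- then leaves no room for the gain term, forcing `v K_p = 0`.
  have hsum : Matrix.vecMul a F ⬝ᵥ P.mulVec (Matrix.vecMul a F)
      + Matrix.vecMul b F ⬝ᵥ P.mulVec (Matrix.vecMul b F)
      = (z.re ^ 2 + z.im ^ 2) * (a ⬝ᵥ P.mulVec a + b ⬝ᵥ P.mulVec b) := by
    rw [haF, hbF]
    simp only [Matrix.mulVec_add, Matrix.mulVec_sub, Matrix.mulVec_smul, dotProduct_add,
      dotProduct_sub, add_dotProduct, sub_dotProduct, smul_dotProduct, dotProduct_smul,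
      smul_eq_mul, hPab]
    ring
  have hKa0 : 0 ≤ Matrix.vecMul a (M.Kp P) ⬝ᵥ Matrix.vecMul a (M.Kp P) := by
    simpa using dotProduct_star_self_nonneg (Matrix.vecMul a (M.Kp P))
  have hKb0 : 0 ≤ Matrix.vecMul b (M.Kp P) ⬝ᵥ Matrix.vecMul b (M.Kp P) := by
    simpa using dotProduct_star_self_nonneg (Matrix.vecMul b (M.Kp P))
  have hσ2 : 0 < M.σ ^ 2 := by positivity
  have hKsum : M.σ ^ 2 * (Matrix.vecMul a (M.Kp P) ⬝ᵥ Matrix.vecMul a (M.Kp P)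
      + Matrix.vecMul b (M.Kp P) ⬝ᵥ Matrix.vecMul b (M.Kp P)) ≤ 0 := by
    nlinarith
  have hK := nonpos_of_mul_nonpos_right hKsum hσ2
  have hKa : Matrix.vecMul a (M.Kp P) = 0 := dotProduct_self_eq_zero.1 (by linarith)
  have hKb : Matrix.vecMul b (M.Kp P) = 0 := dotProduct_self_eq_zero.1 (by linarith)
  -- With `v K_p = 0`, `v` is a left eigenvector of `A` for the same `z`, against the stability of
  -- `A`.
  have hvA : Matrix.vecMul v (M.A.map (algebraMap ℝ ℂ)) = z • v := by
    rw [← hvF]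
    ext i
    have e : M.A = F + M.Kp P := by rw [hF]; abel
    apply Complex.ext
    · rw [hre, hre, e, Matrix.vecMul_add, hKa, add_zero]
    · rw [him, him, e, Matrix.vecMul_add, hKb, add_zero]
  refine absurd (hA z ?_) (not_lt.2 hz1)
  rw [spectrum.mem_iff, Matrix.isUnit_iff_isUnit_det, isUnit_iff_ne_zero, not_not]
  refine Matrix.exists_vecMul_eq_zero_iff.1 ⟨v, hv0, ?_⟩
  rw [Matrix.vecMul_sub, hvA, Algebra.algebraMap_eq_smul_one, Matrix.vecMul_smul, Matrix.vecMul_one,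
    sub_self]

theorem IsStabilizingSolution.eq (hP : M.IsStabilizingSolution P)
    (hX : M.IsStabilizingSolution X) : X = P := by
  have h1 : X - P = (M.A - M.Kp X) * (X - P) * (M.A - M.Kp P).transpose := by
    rw [← riccatiStep_sub hX.isUnit_det hP.isUnit_det hP.symm]
    congr 1
    · exact hX.riccati
    · exact hP.riccati
  exact sub_eq_zero.1 (hX.stable.eq_zero_of_eq_mul_mul hP.stable h1)

theorem exists_isLyapunovSolution (hP : IsStableMatrix (M.A - M.Kp P)) :
    ∃ P', M.IsLyapunovSolution P P' := by
  obtain ⟨P', hP'⟩ := hP.exists_lyapunov (M.Kp P * (M.Kp P).transpose)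
  have h := Matrix.posSemidef_self_mul_conjTranspose (M.Kp P)
  rw [Matrix.conjTranspose_eq_transpose_of_trivial] at h
  exact ⟨P', hP.posSemidef_of_lyapunov h hP', hP'⟩

theorem IsLyapunovSolution.eq {P' : Matrix (Fin m) (Fin m) ℝ}
    (hP : IsStableMatrix (M.A - M.Kp P)) (hP' : M.IsLyapunovSolution P P')
    (hX : M.IsLyapunovSolution P X) : X = P' := by
  refine sub_eq_zero.1 (hP.eq_zero_of_eq_mul_mul hP ?_)
  nth_rw 1 [hX.lyapunov, hP'.lyapunov]
  noncomm_ring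

end VectorModel

/-! ### Stein's lemma -/

section Stein

variable {X : Type*} [MeasurableSpace X] {μ ν : Measure X} {L : X → ℝ}

theorem integrable_exp_neg_of_withDensity [IsFiniteMeasure ν] (hL : Measurable L)
    (hν : ν = μ.withDensity fun x => ENNReal.ofReal (Real.exp (-L x))) :
    Integrable (fun x => Real.exp (-L x)) μ := by
  refine ⟨by fun_prop, ?_⟩
  rw [hasFiniteIntegral_iff_ofReal (ae_of_all _ fun x => (Real.exp_pos _).le)]
  have h1 : ν Set.univ = ∫⁻ x, ENNReal.ofReal (Real.exp (-L x)) ∂μ := by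
    rw [hν, withDensity_apply _ MeasurableSet.univ, Measure.restrict_univ]
  rw [← h1]
  exact measure_lt_top _ _

theorem integral_eq_integral_mul_exp_neg (hL : Measurable L)
    (hν : ν = μ.withDensity fun x => ENNReal.ofReal (Real.exp (-L x))) (f : X → ℝ) :
    ∫ x, f x ∂ν = ∫ x, Real.exp (-L x) * f x ∂μ := by
  rw [hν, integral_withDensity_eq_integral_toReal_smul (by fun_prop)
    (ae_of_all _ fun x => ENNReal.ofReal_lt_top)]
  simp [ENNReal.toReal_ofReal (Real.exp_pos _).le]

variable [IsProbabilityMeasure μ]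

theorem MeasureTheory.Integrable.of_mem_Icc_zero_one {μ : Measure X} [IsProbabilityMeasure μ] {φ : X → ℝ}
    (hφ : Measurable φ) (hφ' : ∀ y, φ y ∈ Set.Icc (0 : ℝ) 1) : Integrable φ μ :=
  Integrable.of_mem_Icc 0 1 hφ.aemeasurable (ae_of_all _ hφ')

/-- The miss probability of a test of level `α` is bounded below through the upper tail of the
log-likelihood ratio. -/
theorem mul_le_missProb [IsFiniteMeasure ν] (hL : Measurable L)
    (hν : ν = μ.withDensity fun x => ENNReal.ofReal (Real.exp (-L x))) {φ : X → ℝ}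
    (hφ : Measurable φ) (hφ' : ∀ y, φ y ∈ Set.Icc (0 : ℝ) 1) {α : ℝ} (hα : ∫ x, φ x ∂μ ≤ α)
    (c : ℝ) : Real.exp (-c) * (1 - α - μ.real {x | c < L x}) ≤ ∫ x, (1 - φ x) ∂ν := by
  have hs : MeasurableSet {x | c < L x} := measurableSet_lt measurable_const hL
  have hint := Integrable.of_mem_Icc_zero_one (μ := μ) hφ hφ'
  have hind : Integrable ({x | c < L x}.indicator fun _ => (1 : ℝ)) μ :=
    (integrable_const 1).indicator hs
  rw [integral_eq_integral_mul_exp_neg hL hν]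
  calc Real.exp (-c) * (1 - α - μ.real {x | c < L x})
      ≤ Real.exp (-c) * (1 - ∫ x, φ x ∂μ - μ.real {x | c < L x}) := by gcongr
    _ = ∫ x, Real.exp (-c) * (1 - φ x - {x | c < L x}.indicator (fun _ => (1 : ℝ)) x) ∂μ := by
        have h1 : Integrable (fun x => 1 - φ x) μ := (integrable_const 1).sub hint
        rw [integral_const_mul, integral_sub h1 hind, integral_sub (integrable_const _) hint,
          integral_indicator_const _ hs]
        simp
    _ ≤ ∫ x, Real.exp (-L x) * (1 - φ x) ∂μ := by
        refine integral_mono ((((integrable_const _).sub hint).sub hind).const_mul _) ?_ fun x => ?_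
        · refine (integrable_exp_neg_of_withDensity hL hν).mul_bdd (c := 1) (by fun_prop)
            (ae_of_all _ fun x => ?_)
          have := hφ' x
          rw [Real.norm_eq_abs, abs_le]
          constructor <;> linarith [this.1, this.2]
        · have := hφ' x
          simp only [Set.indicator_apply, Set.mem_ofPred_eq]
          -- Where `L > c` the lower bound is nonpositive, since `φ ≥ 0`; elsewhere `exp (-L) ≥ exp
          -- (-c)`.
          split_ifs with h
          · have h1 : Real.exp (-c) * (1 - φ x - 1) ≤ 0 :=
              mul_nonpos_of_nonneg_of_nonpos (Real.exp_pos _).le (by linarith [this.1])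
            exact h1.trans (mul_nonneg (Real.exp_pos _).le (by linarith [this.2]))
          · rw [sub_zero]
            have : 0 ≤ 1 - φ x := by linarith [this.2]
            gcongr
            linarith

/-- The likelihood ratio test with threshold `c` has miss probability at most `exp (-c)`. -/
theorem missProb_likelihoodTest_le (hL : Measurable L)
    (hν : ν = μ.withDensity fun x => ENNReal.ofReal (Real.exp (-L x))) (c : ℝ) :
    ∫ x, (1 - {x | L x < c}.indicator (fun _ => (1 : ℝ)) x) ∂ν ≤ Real.exp (-c) := by
  rw [integral_eq_integral_mul_exp_neg hL hν]
  calc _ ≤ ∫ _, Real.exp (-c) ∂μ := by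
        refine integral_mono_of_nonneg (ae_of_all _ fun x => ?_) (integrable_const _)
          (ae_of_all _ fun x => ?_)
        · refine mul_nonneg (Real.exp_pos _).le ?_
          simp only [Set.indicator_apply]
          split_ifs <;> simp
        · simp only [Set.indicator_apply, Set.mem_ofPred_eq]
          split_ifs with h
          · simpa using (Real.exp_pos _).le
          · simpa using h
    _ = Real.exp (-c) := by simp

/-- Since `L` is finite everywhere, its upper tail vanishes. This gives strict positivity of the
least miss probability for each fixed `N`, without asymptotics. -/
theorem exists_measureReal_lt (hL : Measurable L) {ε : ℝ} (hε : 0 < ε) :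
    ∃ c, μ.real {x | c < L x} < ε := by
  have h1 : Tendsto (fun n : ℕ => μ {x | (n : ℝ) < L x}) atTop
      (𝓝 (μ (⋂ n : ℕ, {x | (n : ℝ) < L x}))) := by
    refine tendsto_measure_iInter_atTop
      (fun n => (measurableSet_lt measurable_const hL).nullMeasurableSet) ?_
      ⟨0, measure_ne_top _ _⟩
    intro i j hij x hx
    have : (i : ℝ) ≤ j := by exact_mod_cast hij
    exact this.trans_lt hx
  have h2 : (⋂ n : ℕ, {x | (n : ℝ) < L x}) = ∅ := by
    ext x
    simp only [Set.mem_iInter, Set.mem_ofPred_eq, Set.mem_empty_iff_false, iff_false, not_forall,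
      not_lt]
    exact exists_nat_ge (L x)
  rw [h2, measure_empty] at h1
  obtain ⟨n, hn⟩ := (h1.eventually_lt_const (ENNReal.ofReal_pos.2 hε)).exists
  exact ⟨n, (ENNReal.lt_ofReal_iff_toReal_lt (measure_ne_top _ _)).1 hn⟩

end Stein

/-- **Stein's lemma**: when the normalized log-likelihood ratios converge to `κ` in probability
under the null hypotheses, the least miss probabilities at level `α` decay with exponent `κ`. -/
theorem stein_lemma {X : ℕ → Type*} [∀ N, MeasurableSpace (X N)] {μ ν : ∀ N, Measure (X N)}
    [∀ N, IsProbabilityMeasure (μ N)] [∀ N, IsProbabilityMeasure (ν N)] {L : ∀ N, X N → ℝ}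
    (hL : ∀ N, Measurable (L N))
    (hν : ∀ N, ν N = (μ N).withDensity fun x => ENNReal.ofReal (Real.exp (-L N x))) {κ : ℝ}
    (hκ : ∀ ε > 0, Tendsto (fun N : ℕ => (μ N).real {x | ε * N ≤ |L N x - N * κ|}) atTop (𝓝 0))
    {α : ℝ} (hα : α ∈ Set.Ioo (0 : ℝ) 1) {β : ℕ → ℝ}
    (hβ : ∀ N, β N = sInf {b | ∃ φ : X N → ℝ, (Measurable φ ∧ ∀ y, φ y ∈ Set.Icc (0 : ℝ) 1) ∧
      ∫ x, φ x ∂(μ N) ≤ α ∧ ∫ x, (1 - φ x) ∂(ν N) = b}) :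
    (∀ N, 0 < β N) ∧ Tendsto (fun N : ℕ => -(1 / (N : ℝ)) * Real.log (β N)) atTop (𝓝 κ) := by
  obtain ⟨hα0, hα1⟩ := hα
  have hlow : ∀ N c, Real.exp (-c) * (1 - α - (μ N).real {x | c < L N x}) ≤ β N := by
    intro N c
    rw [hβ]
    -- The test that always decides for H₀ shows that the infimum is over a nonempty set.
    refine le_csInf ⟨_, fun _ => 0, ⟨measurable_const, fun _ => by simp⟩, by simpa using hα0.le,
      rfl⟩ ?_
    rintro b ⟨φ, ⟨hφ, hφ'⟩, h1, rfl⟩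
    exact mul_le_missProb (hL N) (hν N) hφ hφ' h1 c
  have hup : ∀ N c, (μ N).real {x | L N x < c} ≤ α → β N ≤ Real.exp (-c) := by
    intro N c hc
    have hs : MeasurableSet {x | L N x < c} := measurableSet_lt (hL N) measurable_const
    rw [hβ]
    have h := missProb_likelihoodTest_le (hL N) (hν N) c
    refine le_trans (csInf_le ⟨0, ?_⟩ ⟨{x | L N x < c}.indicator fun _ => 1, ⟨?_, ?_⟩, ?_, rfl⟩) h
    · rintro b ⟨φ, ⟨-, hφ⟩, -, rfl⟩
      exact integral_nonneg fun x => by simpa using (hφ x).2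
    · exact measurable_const.indicator hs
    · intro y
      simp only [Set.indicator_apply]
      split_ifs <;> simp
    · rw [integral_indicator_const _ hs]
      simpa using hc
  have hpos : ∀ N, 0 < β N := by
    intro N
    obtain ⟨c, hc⟩ := exists_measureReal_lt (μ := μ N) (hL N) (show 0 < 1 - α by linarith)
    exact (mul_pos (Real.exp_pos _) (by linarith)).trans_le (hlow N c)
  refine ⟨hpos, ?_⟩
  rw [Metric.tendsto_atTop]
  intro ε hε
  set ε' := ε / 3 with hε'
  have hε0 : 0 < ε' := by positivity
  -- The bound `α` makes the likelihood test with threshold `N (κ - ε')` admissible; the bound `(1 -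
  -- α) / 2` keeps the factor in the converse at least `(1 - α) / 2`, a constant lost after division
  -- by `N`.
  have h1 := (hκ ε' hε0).eventually_lt_const (show 0 < min α ((1 - α) / 2) from
    lt_min hα0 (by linarith))
  have h2 : Tendsto (fun N : ℕ => -Real.log ((1 - α) / 2) / (N : ℝ)) atTop (𝓝 0) :=
    tendsto_const_div_atTop_nhds_zero_nat _
  obtain ⟨N₀, hN₀⟩ := eventually_atTop.1
    ((h1.and (h2.eventually_lt_const hε0)).and (eventually_gt_atTop 0))
  refine ⟨N₀, fun N hN => ?_⟩
  obtain ⟨⟨h3, h4⟩, hNpos⟩ := hN₀ N hN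
  have hN0 : (0 : ℝ) < N := by exact_mod_cast hNpos
  have hsub1 : (μ N).real {x | N * (κ + ε') < L N x}
      ≤ (μ N).real {x | ε' * N ≤ |L N x - N * κ|} := by
    refine measureReal_mono fun x hx => ?_
    simp only [Set.mem_ofPred_eq] at hx ⊢
    exact le_trans (by linarith) (le_abs_self _)
  have hsub2 : (μ N).real {x | L N x < N * (κ - ε')}
      ≤ (μ N).real {x | ε' * N ≤ |L N x - N * κ|} := by
    refine measureReal_mono fun x hx => ?_
    simp only [Set.mem_ofPred_eq] at hx ⊢
    exact le_trans (by linarith) (neg_le_abs _)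
  have hU := hup N (N * (κ - ε')) (hsub2.trans (h3.le.trans (min_le_left _ _)))
  have hL' : Real.exp (-(N * (κ + ε'))) * ((1 - α) / 2) ≤ β N := by
    refine le_trans ?_ (hlow N (N * (κ + ε')))
    gcongr
    linarith [min_le_right α ((1 - α) / 2)]
  have hlogU := Real.log_le_log (hpos N) hU
  have hlogL := Real.log_le_log (mul_pos (Real.exp_pos _) (by linarith)) hL'
  rw [Real.log_exp] at hlogU
  rw [Real.log_mul (Real.exp_pos _).ne' (by linarith), Real.log_exp] at hlogL
  have e1 : -(1 / (N : ℝ)) * Real.log (β N) = -Real.log (β N) / N := by ring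
  rw [div_lt_iff₀ hN0] at h4
  rw [Real.dist_eq, e1, abs_lt]
  constructor
  · rw [lt_sub_iff_add_lt, lt_div_iff₀ hN0]
    nlinarith
  · rw [sub_lt_iff_lt_add, div_lt_iff₀ hN0]
    nlinarith

/-! ### Standard Gaussian measures -/

section StdGaussian

open scoped RealInnerProductSpace

variable {V : Type*} [NormedAddCommGroup V] [InnerProductSpace ℝ V] [FiniteDimensional ℝ V]

/-- The quadratic form `(‖T x‖² - ‖x‖²) / 2` is given by a symmetric operator. -/
theorem exists_isSymmetric_inner_eq (T : V →ₗ[ℝ] V) : ∃ S : V →ₗ[ℝ] V, S.IsSymmetric ∧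
    ∀ x, ⟪x, S x⟫ = (‖T x‖ ^ 2 - ‖x‖ ^ 2) / 2 := by
  refine ⟨(1 / 2 : ℝ) • (LinearMap.adjoint T ∘ₗ T - LinearMap.id), fun x y => ?_, fun x => ?_⟩
  · rw [LinearMap.smul_apply, LinearMap.smul_apply, real_inner_smul_left, real_inner_smul_right,
      LinearMap.sub_apply, LinearMap.sub_apply, inner_sub_left, inner_sub_right,
      LinearMap.comp_apply, LinearMap.comp_apply, LinearMap.adjoint_inner_left,
      LinearMap.adjoint_inner_right, LinearMap.id_apply, LinearMap.id_apply]
  · rw [LinearMap.smul_apply, real_inner_smul_right, LinearMap.sub_apply, inner_sub_right,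
      LinearMap.comp_apply, LinearMap.adjoint_inner_right, LinearMap.id_apply,
      real_inner_self_eq_norm_sq, real_inner_self_eq_norm_sq]
    ring

variable [MeasurableSpace V] [BorelSpace V]

/-- Both sides have the same characteristic function, by the Gaussian Fourier integral. -/
theorem stdGaussian_eq_withDensity :
    stdGaussian V = volume.withDensity fun x => ENNReal.ofReal
      (((2 * Real.pi) ^ (Module.finrank ℝ V / 2 : ℝ))⁻¹ * Real.exp (-(‖x‖ ^ 2 / 2))) := by
  have hint : Integrable (fun x : V =>
      ((2 * Real.pi) ^ (Module.finrank ℝ V / 2 : ℝ))⁻¹ * Real.exp (-(‖x‖ ^ 2 / 2))) := by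
    refine Integrable.const_mul ?_ _
    have h1 := (GaussianFourier.integrable_cexp_neg_mul_sq_norm_add (V := V) (b := (1 / 2 : ℂ))
      (by norm_num) 0 0).re
    refine h1.congr (ae_of_all _ fun x => ?_)
    have : (-(1 / 2 : ℂ) * ‖x‖ ^ 2 + 0 * (⟪(0 : V), x⟫ : ℝ)) = ((-(‖x‖ ^ 2 / 2) : ℝ) : ℂ) := by
      push_cast; ring
    simp only [this, ← Complex.ofReal_exp]
    exact Complex.ofReal_re _
  have hc : 0 ≤ ((2 * Real.pi) ^ (Module.finrank ℝ V / 2 : ℝ))⁻¹ := by positivity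
  have : IsFiniteMeasure ((volume : Measure V).withDensity fun x => ENNReal.ofReal
      (((2 * Real.pi) ^ (Module.finrank ℝ V / 2 : ℝ))⁻¹ * Real.exp (-(‖x‖ ^ 2 / 2)))) :=
    isFiniteMeasure_withDensity_ofReal hint.2
  apply Measure.ext_of_charFun
  ext t
  rw [charFun_stdGaussian, charFun_apply, integral_withDensity_eq_integral_toReal_smul
    (by fun_prop) (ae_of_all _ fun x => ENNReal.ofReal_lt_top)]
  have h2 : ∀ x : V, (ENNReal.ofReal (((2 * Real.pi) ^ (Module.finrank ℝ V / 2 : ℝ))⁻¹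
      * Real.exp (-(‖x‖ ^ 2 / 2)))).toReal • Complex.exp ((⟪x, t⟫ : ℝ) * Complex.I)
      = (((2 * Real.pi) ^ (Module.finrank ℝ V / 2 : ℝ) : ℝ) : ℂ)⁻¹
        * Complex.exp (-(1 / 2 : ℂ) * ‖x‖ ^ 2 + Complex.I * (⟪t, x⟫ : ℝ)) := by
    intro x
    rw [ENNReal.toReal_ofReal (mul_nonneg hc (Real.exp_pos _).le), Complex.real_smul,
      Complex.ofReal_mul, Complex.ofReal_exp, mul_assoc, ← Complex.exp_add, Complex.ofReal_inv,
      real_inner_comm]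
    congr 2
    push_cast
    ring
  simp_rw [h2]
  rw [integral_const_mul, GaussianFourier.integral_cexp_neg_mul_sq_norm_add (by norm_num)]
  have h3 : ((Real.pi : ℂ) / (1 / 2)) ^ ((Module.finrank ℝ V : ℂ) / 2)
      = (((2 * Real.pi) ^ (Module.finrank ℝ V / 2 : ℝ) : ℝ) : ℂ) := by
    rw [Complex.ofReal_cpow (by positivity)]
    push_cast
    congr 1
    ring
  rw [h3, inv_mul_cancel_left₀]
  · rw [Complex.I_sq]
    congr 1
    ring
  · exact_mod_cast (Real.rpow_pos_of_pos (by positivity) _).ne'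

/-- The density of a nondegenerate linear image of the standard Gaussian measure. -/
theorem stdGaussian_map_linearEquiv (T : V ≃ₗ[ℝ] V) :
    (stdGaussian V).map T = (stdGaussian V).withDensity fun x => ENNReal.ofReal
      (Real.exp (-(Real.log |LinearMap.det (T : V →ₗ[ℝ] V)|
        + (‖T.symm x‖ ^ 2 - ‖x‖ ^ 2) / 2))) := by
  have hTm : Measurable T := T.toContinuousLinearEquiv.continuous.measurable
  have hTm' : Measurable T.symm := T.symm.toContinuousLinearEquiv.continuous.measurable
  have hdet : LinearMap.det (T : V →ₗ[ℝ] V) ≠ 0 := T.isUnit_det'.ne_zero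
  set c := ((2 * Real.pi) ^ (Module.finrank ℝ V / 2 : ℝ))⁻¹ with hc
  have hc0 : 0 ≤ c := by positivity
  ext s hs
  rw [Measure.map_apply hTm hs, stdGaussian_eq_withDensity, ← hc,
    ← withDensity_mul _ (by fun_prop) (by fun_prop),
    withDensity_apply _ (hTm hs), withDensity_apply _ hs]
  -- Change of variables: `T` scales Lebesgue measure by `|det T|⁻¹`. Dividing by the standard
  -- density leaves `(‖T⁻¹ x‖² - ‖x‖²) / 2` in the exponent.
  have h1 := Measure.map_linearMap_addHaar_eq_smul_addHaar (volume : Measure V) hdet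
  have h2 : ∫⁻ x in T ⁻¹' s, ENNReal.ofReal (c * Real.exp (-(‖x‖ ^ 2 / 2)))
      = ∫⁻ x in s, ENNReal.ofReal (c * Real.exp (-(‖T.symm x‖ ^ 2 / 2)))
        ∂(Measure.map (T : V →ₗ[ℝ] V) volume) := by
    rw [LinearEquiv.coe_coe, setLIntegral_map hs (f := fun x => ENNReal.ofReal
      (c * Real.exp (-(‖T.symm x‖ ^ 2 / 2)))) (by fun_prop) hTm]
    simp
  rw [h2, h1, Measure.restrict_smul, lintegral_smul_measure, smul_eq_mul,
    ← lintegral_const_mul _ (by fun_prop)]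
  refine lintegral_congr fun x => ?_
  rw [Pi.mul_apply, ← ENNReal.ofReal_mul (abs_nonneg _), ← ENNReal.ofReal_mul
    (mul_nonneg hc0 (Real.exp_pos _).le)]
  congr 1
  rw [mul_assoc, ← Real.exp_add, neg_add, ← add_assoc, Real.exp_add (_ + _), add_comm (-(_ / _)),
    Real.exp_add, Real.exp_neg (Real.log _), Real.exp_log (abs_pos.2 hdet), abs_inv,
    mul_assoc, ← Real.exp_add, mul_left_comm]
  congr 4
  ring

theorem memLp_sq_gaussianReal : MemLp (fun x : ℝ => x ^ 2) 2 (gaussianReal 0 1) := by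
  rw [memLp_two_iff_integrable_sq (by fun_prop)]
  have h := (memLp_id_gaussianReal (μ := 0) (v := 1) 4).integrable_norm_pow (by norm_num)
  refine h.congr (ae_of_all _ fun x => ?_)
  simp only [id_eq, Real.norm_eq_abs, ← pow_mul]
  exact Even.pow_abs (by decide) x

/-- The variance of a quadratic form of a standard Gaussian vector. -/
theorem variance_quadraticForm_stdGaussian_le {S : V →ₗ[ℝ] V} (hS : S.IsSymmetric) {c : ℝ}
    (hc : ∀ x, |⟪x, S x⟫| ≤ c * ‖x‖ ^ 2) :
    MemLp (fun x => ⟪x, S x⟫) 2 (stdGaussian V) ∧ Var[fun x => ⟪x, S x⟫; stdGaussian V]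
      ≤ Module.finrank ℝ V * (c ^ 2 * Var[fun x : ℝ => x ^ 2; gaussianReal 0 1]) := by
  -- In an orthonormal eigenbasis the coordinates are independent standard normals and the form is
  -- `∑ λ_i x_i²` with `|λ_i| ≤ c`, so variances add.
  set b := hS.eigenvectorBasis rfl
  set l := hS.eigenvalues rfl
  have hmeas : Measurable fun x : Fin (Module.finrank ℝ V) → ℝ => ∑ i, x i • b i := by fun_prop
  have hSm : Measurable S := S.toContinuousLinearMap.continuous.measurable
  have hl : ∀ i, |l i| ≤ c := by
    intro i
    have h1 := hc (b i)
    have h2 : S (b i) = l i • b i := hS.apply_eigenvectorBasis rfl i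
    rw [h2, real_inner_smul_right, real_inner_self_eq_norm_sq, b.norm_eq_one] at h1
    simpa using h1
  have hform : (fun x => ⟪x, S x⟫) ∘ (fun x : Fin (Module.finrank ℝ V) → ℝ => ∑ i, x i • b i)
      = ∑ i, fun x : Fin (Module.finrank ℝ V) → ℝ => l i * x i ^ 2 := by
    ext x
    have h1 : S (∑ i, x i • b i) = ∑ i, (l i * x i) • b i := by
      rw [map_sum]
      refine Finset.sum_congr rfl fun i _ => ?_
      have h2 : S (b i) = l i • b i := hS.apply_eigenvectorBasis rfl i
      rw [map_smul, h2, smul_smul, mul_comm]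
    simp only [Function.comp_apply, h1, Finset.sum_apply]
    rw [b.orthonormal.inner_sum]
    refine Finset.sum_congr rfl fun i _ => ?_
    simp
    ring
  have hmem : ∀ i, MemLp (fun x : ℝ => l i * x ^ 2) 2 (gaussianReal 0 1) := fun i =>
    memLp_sq_gaussianReal.const_mul _
  have hq : AEStronglyMeasurable (fun x => ⟪x, S x⟫) ((Measure.pi fun _ => gaussianReal 0 1).map
      fun x : Fin (Module.finrank ℝ V) → ℝ => ∑ i, x i • b i) :=
    (Measurable.inner measurable_id hSm).aestronglyMeasurable
  rw [stdGaussian_eq_map_pi_orthonormalBasis b]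
  constructor
  · rw [memLp_map_measure_iff hq hmeas.aemeasurable, hform]
    refine memLp_finsetSum' _ fun i _ => ?_
    exact (hmem i).comp_measurePreserving (measurePreserving_eval _ i)
  · rw [variance_map hq.aemeasurable hmeas.aemeasurable, hform,
      variance_sum_pi (X := fun i (x : ℝ) => l i * x ^ 2) hmem]
    calc ∑ i, Var[fun x : ℝ => l i * x ^ 2; gaussianReal 0 1]
        ≤ ∑ _ : Fin (Module.finrank ℝ V), c ^ 2 * Var[fun x : ℝ => x ^ 2; gaussianReal 0 1] := by
          refine Finset.sum_le_sum fun i _ => ?_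
          rw [variance_const_mul]
          exact mul_le_mul_of_nonneg_right (sq_le_sq' (abs_le.1 (hl i)).1 (abs_le.1 (hl i)).2)
            (variance_nonneg _ _)
      _ = _ := by simp

theorem measurable_linearEquiv (T : V ≃ₗ[ℝ] V) : Measurable T :=
  T.toContinuousLinearEquiv.continuous.measurable

/-- The log-likelihood ratio of two centred Gaussian vectors has variance of the order of the
dimension. -/
theorem variance_norm_sq_sub_le (T : V →ₗ[ℝ] V) (hT : ∀ x, ‖T x‖ ≤ ‖x‖) (a : ℝ) :
    MemLp (fun x => a + (‖T x‖ ^ 2 - ‖x‖ ^ 2) / 2) 2 (stdGaussian V) ∧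
      Var[fun x => a + (‖T x‖ ^ 2 - ‖x‖ ^ 2) / 2; stdGaussian V]
        ≤ Module.finrank ℝ V * ((1 / 2) ^ 2 * Var[fun x : ℝ => x ^ 2; gaussianReal 0 1]) := by
  obtain ⟨S, hS, hq⟩ := exists_isSymmetric_inner_eq T
  -- The contraction hypothesis places the form between `-‖x‖² / 2` and `0`.
  have hbound : ∀ x, |⟪x, S x⟫| ≤ 1 / 2 * ‖x‖ ^ 2 := by
    intro x
    have h2 : ‖T x‖ ^ 2 ≤ ‖x‖ ^ 2 := pow_le_pow_left₀ (norm_nonneg _) (hT x) 2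
    rw [hq, abs_le]
    constructor <;> linarith [sq_nonneg ‖T x‖]
  obtain ⟨h1, h2⟩ := variance_quadraticForm_stdGaussian_le hS hbound
  simp only [← hq]
  have hadd : MemLp ((fun _ : V => a) + fun x => ⟪x, S x⟫) 2 (stdGaussian V) :=
    MemLp.add (memLp_const a) h1
  have hvar := variance_const_add h1.aestronglyMeasurable a
  exact ⟨hadd, hvar.trans_le h2⟩

end StdGaussian

open scoped RealInnerProductSpace

/-! ### Characteristic functions of sequences -/

section SequenceLaws

variable {E : Type*} [NormedAddCommGroup E] [InnerProductSpace ℝ E] [FiniteDimensional ℝ E]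
  [MeasurableSpace E] [BorelSpace E]

/-- Laws of random sequences agree when the characteristic functions of their initial segments
agree. -/
theorem ext_of_integral_cexp_sum {μ ν : Measure (ℕ → E)} [IsFiniteMeasure μ] [IsFiniteMeasure ν]
    (h : ∀ (N : ℕ) (t : ℕ → E),
      ∫ y, Complex.exp ((∑ j ∈ Finset.range N, ⟪t j, y j⟫ : ℝ) * Complex.I) ∂μ
        = ∫ y, Complex.exp ((∑ j ∈ Finset.range N, ⟪t j, y j⟫ : ℝ) * Complex.I) ∂ν) : μ = ν := by
  refine IsProjectiveLimit.unique (P := fun I => ν.map I.restrict) (fun I => ?_) (fun I => rfl)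
  have hr : Measurable (I.restrict : (ℕ → E) → I → E) := by fun_prop
  have hto : Measurable (WithLp.toLp 2 : (I → E) → PiLp 2 fun _ : I => E) := by fun_prop
  have key : (μ.map I.restrict).map (WithLp.toLp 2)
      = (ν.map I.restrict).map (WithLp.toLp 2 : (I → E) → PiLp 2 fun _ : I => E) := by
    apply Measure.ext_of_charFun
    ext t
    obtain ⟨N, hN⟩ := I.exists_nat_subset_range
    -- A finite index set is enlarged to an initial segment by zero test vectors.
    have hsum : ∀ y : ℕ → E, ⟪(WithLp.toLp 2 (I.restrict y) : PiLp 2 fun _ : I => E), t⟫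
        = ∑ j ∈ Finset.range N, ⟪if hj : j ∈ I then t ⟨j, hj⟩ else 0, y j⟫ := by
      intro y
      rw [PiLp.inner_apply, ← Finset.sum_subset hN fun j _ hj => by simp [hj],
        ← Finset.sum_coe_sort I fun j => ⟪if hj : j ∈ I then t ⟨j, hj⟩ else 0, y j⟫]
      refine Finset.sum_congr rfl fun j _ => ?_
      simp [real_inner_comm]
    rw [charFun_apply, charFun_apply, Measure.map_map hto hr, Measure.map_map hto hr,
      integral_map (by fun_prop) (by fun_prop), integral_map (by fun_prop) (by fun_prop)]
    simp only [Function.comp_apply, hsum]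
    exact h N _
  have hinv : Measurable (WithLp.ofLp : (PiLp 2 fun _ : I => E) → I → E) := by fun_prop
  have := congrArg (Measure.map WithLp.ofLp) key
  rw [Measure.map_map hinv hto, Measure.map_map hinv hto] at this
  change Measure.map id _ = Measure.map id _ at this
  rwa [Measure.map_id, Measure.map_id] at this

theorem integral_cexp_sum_infinitePi (μ : Measure E) [IsProbabilityMeasure μ] (N : ℕ)
    (a : ℕ → E) :
    ∫ ω, Complex.exp ((∑ j ∈ Finset.range N, ⟪a j, ω j⟫ : ℝ) * Complex.I)
      ∂(Measure.infinitePi fun _ : ℕ => μ) = ∏ j ∈ Finset.range N, charFun μ (a j) := by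
  have h1 : ∀ ω : ℕ → E, Complex.exp ((∑ j ∈ Finset.range N, ⟪a j, ω j⟫ : ℝ) * Complex.I)
      = ∏ j : Finset.range N, Complex.exp ((⟪(Finset.range N).restrict ω j, a j⟫ : ℝ) * Complex.I)
      := by
    intro ω
    rw [← Complex.exp_sum, ← Finset.sum_mul, ← Complex.ofReal_sum, ← Finset.sum_coe_sort]
    simp [real_inner_comm]
  simp_rw [h1]
  have h2 := integral_restrict_infinitePi (μ := fun _ : ℕ => μ) (s := Finset.range N)
    (f := fun x : Finset.range N → E =>
      ∏ j : Finset.range N, Complex.exp ((⟪x j, a j⟫ : ℝ) * Complex.I))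
    (Measurable.aestronglyMeasurable (by fun_prop))
  rw [h2, integral_fintype_prod_eq_prod (f := fun (j : Finset.range N) (x : E) =>
    Complex.exp ((⟪x, a j⟫ : ℝ) * Complex.I)), Finset.prod_coe_sort (Finset.range N)
    (fun j => ∫ x, Complex.exp ((⟪x, a j⟫ : ℝ) * Complex.I) ∂μ)]
  rfl

end SequenceLaws

/-! ### Adjoint recursions and summation by parts. -/

section SummationByParts

variable {E : Type*} [NormedAddCommGroup E] [InnerProductSpace ℝ E] [FiniteDimensional ℝ E]

/-- Summation by parts for a linear recursion. -/
theorem sum_inner_eq_of_recursion {A : E →L[ℝ] E} {x d t l : ℕ → E} {N : ℕ}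
    (hx : ∀ i < N, x (i + 1) = A (x i) + d i)
    (hl : ∀ i < N, l i = t i + ContinuousLinearMap.adjoint A (l (i + 1))) (hN : l N = 0) :
    ∑ j ∈ Finset.range N, ⟪t j, x j⟫ = ⟪l 0, x 0⟫ + ∑ j ∈ Finset.range N, ⟪l (j + 1), d j⟫ := by
  have h1 : ∀ j ∈ Finset.range N, ⟪t j, x j⟫ - ⟪l (j + 1), d j⟫
      = ⟪l j, x j⟫ - ⟪l (j + 1), x (j + 1)⟫ := by
    intro j hj
    have hj' := Finset.mem_range.1 hj
    rw [hx j hj', hl j hj', inner_add_left, inner_add_right,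
      ContinuousLinearMap.adjoint_inner_left]
    ring
  have h2 := Finset.sum_congr rfl h1
  rw [Finset.sum_range_sub', hN, inner_zero_left, sub_zero, Finset.sum_sub_distrib] at h2
  linarith

/-- The adjoint recursion is solved backwards from time `N`; `c r` is the costate at time `N - r`.
-/
theorem exists_costate (A : E →L[ℝ] E) (t : ℕ → E) (N : ℕ) : ∃ l : ℕ → E,
    (∀ i < N, l i = t i + ContinuousLinearMap.adjoint A (l (i + 1))) ∧ l N = 0 := by
  let c : ℕ → E := fun r => Nat.rec 0 (fun r x => t (N - r - 1) + ContinuousLinearMap.adjoint A x) r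
  refine ⟨fun i => c (N - i), fun i hi => ?_, by simp [c]⟩
  obtain ⟨r, rfl⟩ := Nat.exists_eq_add_of_lt hi
  have e1 : i + r + 1 - i = r + 1 := by omega
  have e2 : i + r + 1 - (i + 1) = r := by omega
  have e3 : i + r + 1 - r - 1 = i := by omega
  simp only [e1, e2, c, e3]

end SummationByParts

/-! ### Linear recursions -/

section LinearRecursion

variable {E : Type*} [NormedAddCommGroup E] [NormedSpace ℝ E]

/-- The solution of `x_{i+1} = F_i x_i + K_i e_i`, `x_0 = 0`. -/
def linearRecursion (F K : ℕ → E →L[ℝ] E) (e : ℕ → E) : ℕ → E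
  | 0 => 0
  | i + 1 => F i (linearRecursion F K e i) + K i (e i)

variable (F K : ℕ → E →L[ℝ] E)

theorem linearRecursion_congr {e e' : ℕ → E} : ∀ {i : ℕ}, (∀ j < i, e j = e' j) →
    linearRecursion F K e i = linearRecursion F K e' i
  | 0, _ => rfl
  | i + 1, h => by
    simp only [linearRecursion]
    rw [linearRecursion_congr fun j hj => h j (by omega), h i (by omega)]

theorem linearRecursion_add (e e' : ℕ → E) : ∀ i : ℕ,
    linearRecursion F K (e + e') i = linearRecursion F K e i + linearRecursion F K e' i
  | 0 => by simp [linearRecursion]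
  | i + 1 => by
    simp only [linearRecursion, linearRecursion_add e e' i, Pi.add_apply, map_add]
    abel

theorem linearRecursion_smul (c : ℝ) (e : ℕ → E) : ∀ i : ℕ,
    linearRecursion F K (c • e) i = c • linearRecursion F K e i
  | 0 => by simp [linearRecursion]
  | i + 1 => by simp [linearRecursion, linearRecursion_smul c e i]

theorem measurable_linearRecursion [MeasurableSpace E] [BorelSpace E] [SecondCountableTopology E] :
    ∀ i : ℕ, Measurable fun e => linearRecursion F K e i
  | 0 => measurable_const
  | i + 1 => by
    have := measurable_linearRecursion i
    simp only [linearRecursion]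
    fun_prop

/-- Feeding a filter with gain `K` with the output of the recursion recovers its state. -/
theorem linearRecursion_sub_gain (A : E →L[ℝ] E) (e : ℕ → E) : ∀ i : ℕ,
    linearRecursion (fun i => A - K i) K (linearRecursion (fun _ => A) K e + e) i
      = linearRecursion (fun _ => A) K e i
  | 0 => rfl
  | i + 1 => by
    simp only [linearRecursion, linearRecursion_sub_gain A e i, Pi.add_apply,
      _root_.sub_apply, map_add]
    abel

end LinearRecursion

/-! ### The innovations representation of the observations -/

theorem adjoint_toEuclideanCLM {m : ℕ} (N : Matrix (Fin m) (Fin m) ℝ) :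
    ContinuousLinearMap.adjoint (Matrix.toEuclideanCLM (𝕜 := ℝ) N)
      = Matrix.toEuclideanCLM (𝕜 := ℝ) N.transpose := by
  rw [← ContinuousLinearMap.star_eq_adjoint, ← map_star, Matrix.star_eq_conjTranspose,
    Matrix.conjTranspose_eq_transpose_of_trivial]

/-- The law of a sequence of independent standard Gaussian vectors. -/
def stdNoise (m : ℕ) : Measure (ℕ → EuclideanSpace ℝ (Fin m)) :=
  Measure.infinitePi fun _ => stdGaussian (EuclideanSpace ℝ (Fin m))

instance (m : ℕ) : IsProbabilityMeasure (stdNoise m) := by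
  unfold stdNoise; infer_instance

theorem multivariateGaussian_zero_sq_smul_one {m : ℕ} (c : ℝ) :
    multivariateGaussian 0 (c ^ 2 • (1 : Matrix (Fin m) (Fin m) ℝ))
      = (stdGaussian (EuclideanSpace ℝ (Fin m))).map (c • ·) := by
  have := Measure.isProbabilityMeasure_map (μ := stdGaussian (EuclideanSpace ℝ (Fin m)))
    (f := (c • ·)) (by fun_prop)
  apply Measure.ext_of_charFun
  ext t
  rw [charFun_multivariateGaussian (Matrix.PosSemidef.one.smul (sq_nonneg c)), charFun_map_smul,
    charFun_stdGaussian, norm_smul, ← Complex.ofReal_pow, mul_pow, EuclideanSpace.real_norm_sq_eq,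
    Real.norm_eq_abs, sq_abs]
  congr 1
  rw [inner_zero_right, Matrix.smul_mulVec, Matrix.one_mulVec, dotProduct_smul, smul_eq_mul]
  simp only [dotProduct, ← pow_two]
  push_cast
  ring

namespace VectorModel

variable {m p : ℕ} (M : VectorModel m p)

/-- The Kalman gain at time `i`. -/
def gain (i : ℕ) : Matrix (Fin m) (Fin m) ℝ := M.Kp (M.riccatiSeq i)

open scoped MatrixOrder in
/-- A square root of the innovation covariance at time `i`. -/
def root (i : ℕ) : Matrix (Fin m) (Fin m) ℝ := CFC.sqrt (M.Re (M.riccatiSeq i))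

/-- The one-step predictor of the observations under `H₁`. -/
def predictor (y : ℕ → EuclideanSpace ℝ (Fin m)) (i : ℕ) : EuclideanSpace ℝ (Fin m) :=
  linearRecursion (fun i => Matrix.toEuclideanCLM (𝕜 := ℝ) M.A
    - Matrix.toEuclideanCLM (𝕜 := ℝ) (M.gain i))
    (fun i => Matrix.toEuclideanCLM (𝕜 := ℝ) (M.gain i)) y i

/-- The innovations built from a standard noise. -/
def colored (w : ℕ → EuclideanSpace ℝ (Fin m)) (i : ℕ) : EuclideanSpace ℝ (Fin m) :=
  Matrix.toEuclideanCLM (𝕜 := ℝ) (M.root i) (w i)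

/-- The observations under `H₁`, as a causal function of a standard noise. -/
def synthesis (w : ℕ → EuclideanSpace ℝ (Fin m)) (i : ℕ) : EuclideanSpace ℝ (Fin m) :=
  linearRecursion (fun _ => Matrix.toEuclideanCLM (𝕜 := ℝ) M.A)
    (fun i => Matrix.toEuclideanCLM (𝕜 := ℝ) (M.gain i)) (M.colored w) i + M.colored w i

theorem measurable_predictor (i : ℕ) : Measurable fun y => M.predictor y i :=
  measurable_linearRecursion _ _ i

theorem measurable_colored : Measurable M.colored := by
  refine measurable_pi_lambda _ fun i => ?_
  unfold colored
  fun_prop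

theorem measurable_synthesis : Measurable M.synthesis := by
  refine measurable_pi_lambda _ fun i => ?_
  exact ((measurable_linearRecursion _ _ i).comp M.measurable_colored).add
    ((measurable_pi_apply i).comp M.measurable_colored)

/-- The predictor, fed with the synthesized observations, reproduces the state of the synthesis
filter, so only the direct term remains. -/
theorem predictor_synthesis (w : ℕ → EuclideanSpace ℝ (Fin m)) (i : ℕ) :
    M.synthesis w i - M.predictor (M.synthesis w) i = M.colored w i := by
  have : M.predictor (M.synthesis w) i = linearRecursion
      (fun _ => Matrix.toEuclideanCLM (𝕜 := ℝ) M.A)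
      (fun i => Matrix.toEuclideanCLM (𝕜 := ℝ) (M.gain i)) (M.colored w) i :=
    linearRecursion_sub_gain _ _ _ _
  rw [this, synthesis]
  abel

theorem measurable_signal (i : ℕ) :
    Measurable fun ω : EuclideanSpace ℝ (Fin m) × (ℕ → EuclideanSpace ℝ (Fin p)) =>
      M.signal ω.1 ω.2 i := by
  have hA : Measurable (Matrix.toEuclideanLin M.A) :=
    (Matrix.toEuclideanLin M.A).toContinuousLinearMap.continuous.measurable
  have hB : Measurable (Matrix.toEuclideanLin M.B) :=
    (Matrix.toEuclideanLin M.B).toContinuousLinearMap.continuous.measurable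
  induction i with
  | zero => exact measurable_fst
  | succ i ih =>
    exact (hA.comp ih).add (hB.comp ((measurable_pi_apply i).comp measurable_snd))

theorem measurable_observation :
    Measurable fun (ω : EuclideanSpace ℝ (Fin m) × (ℕ → EuclideanSpace ℝ (Fin p)) ×
      (ℕ → EuclideanSpace ℝ (Fin m))) i => M.signal ω.1 ω.2.1 i + ω.2.2 i := by
  refine measurable_pi_lambda _ fun i => ?_
  have h : Measurable fun ω : EuclideanSpace ℝ (Fin m) × (ℕ → EuclideanSpace ℝ (Fin p)) ×
      (ℕ → EuclideanSpace ℝ (Fin m)) => (ω.1, ω.2.1) := by fun_prop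
  exact ((M.measurable_signal i).comp h).add (by fun_prop)

instance : IsProbabilityMeasure M.noiseLaw := by unfold noiseLaw; infer_instance

instance : IsProbabilityMeasure M.inputLaw := by unfold inputLaw; infer_instance

instance : IsProbabilityMeasure M.lawH1 := by
  unfold lawH1
  exact Measure.isProbabilityMeasure_map M.measurable_observation.aemeasurable

theorem lawH0_eq_map_stdNoise : M.lawH0 = (stdNoise m).map (M.σ • ·) := by
  rw [lawH0, noiseLaw, stdNoise]
  simp_rw [multivariateGaussian_zero_sq_smul_one]
  rw [← Measure.infinitePi_map_pi _ fun _ => by fun_prop]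
  rfl

variable {M}

open scoped MatrixOrder in
theorem root_mul_root (hσ : 0 < M.σ) (hQ : M.Q.PosSemidef) (hC₀ : M.C₀.PosSemidef)
    (i : ℕ) : M.root i * M.root i = M.Re (M.riccatiSeq i) :=
  CFC.sqrt_mul_sqrt_self _ (posDef_Re hσ (posSemidef_riccatiSeq hσ hQ hC₀ i)).posSemidef.nonneg

open scoped MatrixOrder in
theorem transpose_root (i : ℕ) : (M.root i).transpose = M.root i := by
  have := (CFC.sqrt_nonneg (M.Re (M.riccatiSeq i))).isSelfAdjoint.star_eq
  rwa [Matrix.star_eq_conjTranspose, Matrix.conjTranspose_eq_transpose_of_trivial] at this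

/-- Completing the square in the Riccati recursion. -/
theorem dotProduct_Re_mulVec {P : Matrix (Fin m) (Fin m) ℝ} (h : IsUnit (M.Re P).det)
    (hP : P.IsSymm) {l l' t : Fin m → ℝ} (hl : l = t + M.A.transpose.mulVec l') :
    ((M.Kp P).transpose.mulVec l' + t) ⬝ᵥ (M.Re P).mulVec ((M.Kp P).transpose.mulVec l' + t)
      = l ⬝ᵥ P.mulVec l + M.B.transpose.mulVec l' ⬝ᵥ M.Q.mulVec (M.B.transpose.mulVec l')
        - l' ⬝ᵥ (M.riccatiStep P).mulVec l' + M.σ ^ 2 * (t ⬝ᵥ t) := by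
  have hPt : P.transpose = P := hP
  have move : ∀ {n : ℕ} (N : Matrix (Fin m) (Fin n) ℝ) (x : Fin m → ℝ) (y : Fin n → ℝ),
      N.transpose.mulVec x ⬝ᵥ y = x ⬝ᵥ N.mulVec y := by
    intro n N x y
    rw [Matrix.mulVec_transpose, ← Matrix.dotProduct_mulVec]
  have hKR : M.Kp P * M.Re P = M.A * P := by
    rw [Kp, mul_assoc, Matrix.nonsing_inv_mul _ h, mul_one]
  have hRt : (M.Re P).transpose = M.Re P := by simp [Re, hPt]
  have hRK : M.Re P * (M.Kp P).transpose = P * M.A.transpose := by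
    have := congrArg Matrix.transpose hKR
    rwa [Matrix.transpose_mul, Matrix.transpose_mul, hRt, hPt] at this
  have hstep : M.riccatiStep P = M.A * P * M.A.transpose + M.B * M.Q * M.B.transpose
      - M.A * P * (M.Kp P).transpose := by
    have : (M.Kp P).transpose = (M.Re P)⁻¹ * (P * M.A.transpose) := by
      rw [← hRK, ← mul_assoc, Matrix.nonsing_inv_mul _ h, one_mul]
    rw [riccatiStep, this]
    simp only [mul_assoc]
  have hcross : l' ⬝ᵥ (M.A * P).mulVec t = t ⬝ᵥ (P * M.A.transpose).mulVec l' := by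
    have : P * M.A.transpose = (M.A * P).transpose := by rw [Matrix.transpose_mul, hPt]
    rw [this, dotProduct_comm t, move]
  rw [hl, hstep]
  simp only [Matrix.mulVec_add, add_dotProduct, dotProduct_add, move, Matrix.mulVec_mulVec,
    Matrix.sub_mulVec, Matrix.add_mulVec, dotProduct_sub, hKR, hRK, ← mul_assoc]
  have hKPA : M.Kp P * P * M.A.transpose = M.A * P * (M.Kp P).transpose := by
    rw [mul_assoc, ← hRK, ← mul_assoc, hKR]
  rw [hKPA, Matrix.mul_assoc M.B, Re, Matrix.add_mulVec, Matrix.smul_mulVec, Matrix.one_mulVec,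
    dotProduct_add, dotProduct_smul, smul_eq_mul, hcross]
  ring

theorem norm_sq_root_apply (hσ : 0 < M.σ) (hQ : M.Q.PosSemidef) (hC₀ : M.C₀.PosSemidef)
    (i : ℕ) (x : EuclideanSpace ℝ (Fin m)) :
    ‖Matrix.toEuclideanCLM (𝕜 := ℝ) (M.root i) x‖ ^ 2
      = x ⬝ᵥ (M.Re (M.riccatiSeq i)).mulVec x := by
  rw [← real_inner_self_eq_norm_sq, ← ContinuousLinearMap.adjoint_inner_right,
    adjoint_toEuclideanCLM, transpose_root, ← mul_apply_eq_comp, ← map_mul,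
    root_mul_root hσ hQ hC₀, Matrix.inner_toEuclideanCLM]

/-- The two sides are the variances of `∑ ⟪t j, y j⟫` in the synthesis model and in the
signal-plus-noise model. Completing the square at each time leaves differences of `l_jᵀ P_j l_j`,
which telescope from `P_0 = C₀` to `l_N = 0`. -/
theorem sum_norm_sq_eq (hσ : 0 < M.σ) (hQ : M.Q.PosSemidef) (hC₀ : M.C₀.PosSemidef)
    {N : ℕ} {t l : ℕ → EuclideanSpace ℝ (Fin m)}
    (hl : ∀ i < N, l i = t i + ContinuousLinearMap.adjoint
      (Matrix.toEuclideanCLM (𝕜 := ℝ) M.A) (l (i + 1))) (hN : l N = 0) :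
    ∑ j ∈ Finset.range N, ‖Matrix.toEuclideanCLM (𝕜 := ℝ) (M.root j)
      (ContinuousLinearMap.adjoint (Matrix.toEuclideanCLM (𝕜 := ℝ) (M.gain j)) (l (j + 1)) + t j)‖ ^ 2
      = l 0 ⬝ᵥ M.C₀.mulVec (l 0)
        + ∑ j ∈ Finset.range N, M.B.transpose.mulVec (l (j + 1))
          ⬝ᵥ M.Q.mulVec (M.B.transpose.mulVec (l (j + 1)))
        + M.σ ^ 2 * ∑ j ∈ Finset.range N, ‖t j‖ ^ 2 := by
  have hterm : ∀ j ∈ Finset.range N, ‖Matrix.toEuclideanCLM (𝕜 := ℝ) (M.root j)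
      (ContinuousLinearMap.adjoint (Matrix.toEuclideanCLM (𝕜 := ℝ) (M.gain j)) (l (j + 1)) + t j)‖ ^ 2
      = (l j ⬝ᵥ (M.riccatiSeq j).mulVec (l j)
          - l (j + 1) ⬝ᵥ (M.riccatiSeq (j + 1)).mulVec (l (j + 1)))
        + M.B.transpose.mulVec (l (j + 1)) ⬝ᵥ M.Q.mulVec (M.B.transpose.mulVec (l (j + 1)))
        + M.σ ^ 2 * ‖t j‖ ^ 2 := by
    intro j hj
    have hP := posSemidef_riccatiSeq hσ hQ hC₀ j
    have hs : (M.riccatiSeq j).IsSymm := by simpa [Matrix.IsSymm] using hP.1.eq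
    have hl' : (l j).ofLp = (t j).ofLp + M.A.transpose.mulVec (l (j + 1)).ofLp := by
      rw [hl j (Finset.mem_range.1 hj), adjoint_toEuclideanCLM, WithLp.ofLp_add,
        Matrix.ofLp_toEuclideanCLM]
    rw [norm_sq_root_apply hσ hQ hC₀, adjoint_toEuclideanCLM, WithLp.ofLp_add,
      Matrix.ofLp_toEuclideanCLM, gain, dotProduct_Re_mulVec (isUnit_det_Re hσ hP) hs hl',
      EuclideanSpace.real_norm_sq_eq (t j), riccatiSeq]
    simp only [dotProduct, ← pow_two]
    ring
  rw [Finset.sum_congr rfl hterm, Finset.sum_add_distrib, Finset.sum_add_distrib,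
    Finset.sum_range_sub', hN, Finset.mul_sum]
  simp [riccatiSeq]

/-- The adjoint of the synthesis filter, computed through the costate. -/
theorem sum_inner_synthesis {N : ℕ} {t l : ℕ → EuclideanSpace ℝ (Fin m)}
    (hl : ∀ i < N, l i = t i + ContinuousLinearMap.adjoint
      (Matrix.toEuclideanCLM (𝕜 := ℝ) M.A) (l (i + 1))) (hN : l N = 0)
    (w : ℕ → EuclideanSpace ℝ (Fin m)) :
    ∑ j ∈ Finset.range N, ⟪t j, M.synthesis w j⟫
      = ∑ j ∈ Finset.range N, ⟪Matrix.toEuclideanCLM (𝕜 := ℝ) (M.root j)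
        (ContinuousLinearMap.adjoint (Matrix.toEuclideanCLM (𝕜 := ℝ) (M.gain j)) (l (j + 1)) + t j),
        w j⟫ := by
  have h1 := sum_inner_eq_of_recursion (x := linearRecursion
    (fun _ => Matrix.toEuclideanCLM (𝕜 := ℝ) M.A)
    (fun i => Matrix.toEuclideanCLM (𝕜 := ℝ) (M.gain i)) (M.colored w)) (fun i _ => rfl) hl hN
  simp only [synthesis, inner_add_right, Finset.sum_add_distrib]
  rw [h1, linearRecursion, inner_zero_right, zero_add, ← Finset.sum_add_distrib]
  refine Finset.sum_congr rfl fun j _ => ?_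
  rw [← ContinuousLinearMap.adjoint_inner_right, adjoint_toEuclideanCLM (M.root j),
    transpose_root, inner_add_left, ContinuousLinearMap.adjoint_inner_left]
  rfl

/-- Under `H₁` the observations are a causal and causally invertible linear function of a
standard noise. -/
theorem lawH1_eq_map_stdNoise (hσ : 0 < M.σ) (hQ : M.Q.PosSemidef) (hC₀ : M.C₀.PosSemidef) :
    M.lawH1 = (stdNoise m).map M.synthesis := by
  have := Measure.isProbabilityMeasure_map (μ := stdNoise m) M.measurable_synthesis.aemeasurable
  refine ext_of_integral_cexp_sum fun N t => ?_
  obtain ⟨l, hl, hN⟩ := exists_costate (Matrix.toEuclideanCLM (𝕜 := ℝ) M.A) t N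
  have hmeas : Measurable fun y : ℕ → EuclideanSpace ℝ (Fin m) =>
      Complex.exp ((∑ j ∈ Finset.range N, ⟪t j, y j⟫ : ℝ) * Complex.I) := by fun_prop
  rw [lawH1, integral_map M.measurable_observation.aemeasurable hmeas.aestronglyMeasurable,
    integral_map M.measurable_synthesis.aemeasurable hmeas.aestronglyMeasurable]
  have hsig : ∀ (s : EuclideanSpace ℝ (Fin m)) (u : ℕ → EuclideanSpace ℝ (Fin p)),
      ∑ j ∈ Finset.range N, ⟪t j, M.signal s u j⟫ = ⟪l 0, s⟫
        + ∑ j ∈ Finset.range N, ⟪Matrix.toEuclideanLin M.B.transpose (l (j + 1)), u j⟫ := by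
    intro s u
    rw [sum_inner_eq_of_recursion (x := M.signal s u)
      (d := fun i => Matrix.toEuclideanLin M.B (u i)) (fun i _ => rfl) hl hN, signal]
    congr 1
    refine Finset.sum_congr rfl fun j _ => ?_
    rw [← Matrix.conjTranspose_eq_transpose_of_trivial,
      Matrix.toEuclideanLin_conjTranspose_eq_adjoint, LinearMap.adjoint_inner_left]
  have hleft : ∀ ω : EuclideanSpace ℝ (Fin m) × (ℕ → EuclideanSpace ℝ (Fin p)) ×
      (ℕ → EuclideanSpace ℝ (Fin m)),
      Complex.exp ((∑ j ∈ Finset.range N, ⟪t j, M.signal ω.1 ω.2.1 j + ω.2.2 j⟫ : ℝ) * Complex.I)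
      = Complex.exp ((⟪ω.1, l 0⟫ : ℝ) * Complex.I)
        * (Complex.exp ((∑ j ∈ Finset.range N, ⟪Matrix.toEuclideanLin M.B.transpose (l (j + 1)),
            ω.2.1 j⟫ : ℝ) * Complex.I)
          * Complex.exp ((∑ j ∈ Finset.range N, ⟪t j, ω.2.2 j⟫ : ℝ) * Complex.I)) := by
    intro ω
    simp only [inner_add_right, Finset.sum_add_distrib]
    rw [hsig, ← Complex.exp_add, ← Complex.exp_add, real_inner_comm]
    congr 1
    push_cast
    ring
  simp_rw [hleft, sum_inner_synthesis hl hN]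
  rw [integral_prod_mul (fun s : EuclideanSpace ℝ (Fin m) =>
      Complex.exp ((⟪s, l 0⟫ : ℝ) * Complex.I))
    (fun ω : (ℕ → EuclideanSpace ℝ (Fin p)) × (ℕ → EuclideanSpace ℝ (Fin m)) =>
      Complex.exp ((∑ j ∈ Finset.range N, ⟪Matrix.toEuclideanLin M.B.transpose (l (j + 1)),
            ω.1 j⟫ : ℝ) * Complex.I)
          * Complex.exp ((∑ j ∈ Finset.range N, ⟪t j, ω.2 j⟫ : ℝ) * Complex.I)),
    integral_prod_mul (fun u : ℕ → EuclideanSpace ℝ (Fin p) =>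
      Complex.exp ((∑ j ∈ Finset.range N, ⟪Matrix.toEuclideanLin M.B.transpose (l (j + 1)),
            u j⟫ : ℝ) * Complex.I))
      (fun w : ℕ → EuclideanSpace ℝ (Fin m) =>
        Complex.exp ((∑ j ∈ Finset.range N, ⟪t j, w j⟫ : ℝ) * Complex.I)),
    ← charFun_apply, inputLaw, noiseLaw, stdNoise, integral_cexp_sum_infinitePi,
    integral_cexp_sum_infinitePi, integral_cexp_sum_infinitePi]
  simp only [charFun_stdGaussian, charFun_multivariateGaussian hQ,
    charFun_multivariateGaussian hC₀, inner_zero_right,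
    charFun_multivariateGaussian (Matrix.PosSemidef.one.smul (sq_nonneg M.σ)),
    ← Complex.exp_sum, ← Complex.exp_add]
  congr 1
  -- Both characteristic functions are now exponentials of quadratic forms, and the energy identity
  -- equates the exponents.
  have key := congrArg (fun x : ℝ => (x : ℂ)) (sum_norm_sq_eq hσ hQ hC₀ hl hN)
  have ht : ∀ j, (t j).ofLp ⬝ᵥ (M.σ ^ 2 • (1 : Matrix (Fin m) (Fin m) ℝ)).mulVec (t j).ofLp
      = M.σ ^ 2 * ‖t j‖ ^ 2 := by
    intro j
    rw [Matrix.smul_mulVec, Matrix.one_mulVec, dotProduct_smul, smul_eq_mul,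
      EuclideanSpace.real_norm_sq_eq]
    simp only [dotProduct, pow_two]
  simp only [ht, Matrix.ofLp_toLpLin, Matrix.toLin'_apply, ← Complex.ofReal_pow, ← neg_div,
    ← Finset.sum_div, Finset.sum_neg_distrib, zero_mul, Complex.ofReal_zero, zero_sub,
    ← Complex.ofReal_sum]
  rw [key, Finset.mul_sum]
  push_cast
  ring

end VectorModel

/-! ### Initial segments of the observations -/

section ZeroExtend

variable {E : Type*} [NormedAddCommGroup E] {N : ℕ}

/-- Extension of a finite sequence by zero. -/
def zeroExtend (v : Fin N → E) (j : ℕ) : E := if h : j < N then v ⟨j, h⟩ else 0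

@[simp]
theorem zeroExtend_val (v : Fin N → E) (i : Fin N) : zeroExtend v i = v i := by
  simp [zeroExtend]

theorem zeroExtend_restrict (w : ℕ → E) {j : ℕ} (hj : j < N) :
    zeroExtend (fun i : Fin N => w i) j = w j := by simp [zeroExtend, hj]

theorem zeroExtend_add (v v' : Fin N → E) : zeroExtend (v + v') = zeroExtend v + zeroExtend v' := by
  ext j
  by_cases h : j < N <;> simp [zeroExtend, h]

theorem measurable_zeroExtend [MeasurableSpace E] :
    Measurable (zeroExtend : (Fin N → E) → ℕ → E) := by
  refine measurable_pi_lambda _ fun j => ?_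
  by_cases h : j < N
  · simpa [zeroExtend, h] using measurable_pi_apply _
  · simp [zeroExtend, h]

variable [NormedSpace ℝ E]

theorem zeroExtend_smul (c : ℝ) (v : Fin N → E) : zeroExtend (c • v) = c • zeroExtend v := by
  ext j
  by_cases h : j < N <;> simp [zeroExtend, h]

/-- A linear recursion acting on finite sequences. -/
def finiteRecursion (F K : ℕ → E →L[ℝ] E) (N : ℕ) : (Fin N → E) →ₗ[ℝ] (Fin N → E) where
  toFun v i := linearRecursion F K (zeroExtend v) i
  map_add' v v' := by
    ext1 i
    rw [zeroExtend_add, linearRecursion_add, Pi.add_apply]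
  map_smul' c v := by
    ext1 i
    rw [zeroExtend_smul, linearRecursion_smul]
    rfl

/-- The recursion is strictly causal: each application pushes the first possibly nonzero entry one
step later. -/
theorem finiteRecursion_pow_apply (F K : ℕ → E →L[ℝ] E) (k : ℕ) (v : Fin N → E) (i : Fin N)
    (hi : (i : ℕ) < k) : (finiteRecursion F K N ^ k) v i = 0 := by
  induction k generalizing i with
  | zero => omega
  | succ k ih =>
    rw [pow_succ', Module.End.mul_apply]
    change linearRecursion F K (zeroExtend ((finiteRecursion F K N ^ k) v)) i = 0
    have h0 : ∀ j : ℕ, linearRecursion F K (0 : ℕ → E) j = 0 := by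
      intro j
      induction j with
      | zero => rfl
      | succ j ih => simp [linearRecursion, ih]
    rw [← h0 i]
    refine linearRecursion_congr F K fun j hj => ?_
    have hjN : j < N := hj.trans i.2
    have := ih ⟨j, hjN⟩ (by simp; omega)
    simpa [zeroExtend, hjN] using this

/-- Strict causality makes the recursion nilpotent, so the characteristic polynomial of its negative
is a power of `X`, evaluated here at `1`. -/
theorem det_one_add_finiteRecursion [FiniteDimensional ℝ E] (F K : ℕ → E →L[ℝ] E) (N : ℕ) :
    LinearMap.det (1 + finiteRecursion F K N) = 1 := by
  have hnil : IsNilpotent (-finiteRecursion F K N) :=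
    IsNilpotent.neg ⟨N, LinearMap.ext fun v => funext fun i =>
      finiteRecursion_pow_apply F K N v i i.2⟩
  have h1 := hnil.charpoly_eq_X_pow_finrank
  have h2 := LinearMap.eval_charpoly (-finiteRecursion F K N) 1
  rw [h1] at h2
  simpa using h2.symm

end ZeroExtend

/-! ### Synthesis and whitening filters on finitely many observations. -/

namespace VectorModel

variable {m p : ℕ} {M : VectorModel m p}

theorem synthesis_congr {w w' : ℕ → EuclideanSpace ℝ (Fin m)} {i : ℕ}
    (h : ∀ j ≤ i, w j = w' j) : M.synthesis w i = M.synthesis w' i := by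
  have hc : ∀ j ≤ i, M.colored w j = M.colored w' j := fun j hj => by simp [colored, h j hj]
  rw [synthesis, synthesis, hc i le_rfl, linearRecursion_congr _ _ fun j hj => hc j hj.le]

theorem predictor_congr {y y' : ℕ → EuclideanSpace ℝ (Fin m)} {i : ℕ}
    (h : ∀ j < i, y j = y' j) : M.predictor y i = M.predictor y' i :=
  linearRecursion_congr _ _ h

variable (M)

/-- The Euclidean space of `N` vector observations. -/
abbrev ObsSpace (m N : ℕ) := PiLp 2 fun _ : Fin N => EuclideanSpace ℝ (Fin m)

/-- The synthesis filter acting on finite sequences. -/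
def finiteSynthesis (N : ℕ) :
    (Fin N → EuclideanSpace ℝ (Fin m)) →ₗ[ℝ] (Fin N → EuclideanSpace ℝ (Fin m)) :=
  (1 + finiteRecursion (fun _ => Matrix.toEuclideanCLM (𝕜 := ℝ) M.A)
    (fun i => Matrix.toEuclideanCLM (𝕜 := ℝ) (M.gain i)) N) *
  LinearMap.pi fun i : Fin N => (Matrix.toEuclideanLin (M.root i)).comp (LinearMap.proj i)

theorem finiteSynthesis_apply {N : ℕ} (v : Fin N → EuclideanSpace ℝ (Fin m)) (i : Fin N) :
    M.finiteSynthesis N v i = M.synthesis (zeroExtend v) i := by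
  simp only [finiteSynthesis, Module.End.mul_apply, LinearMap.add_apply, Module.End.one_apply,
    Pi.add_apply, LinearMap.pi_apply, LinearMap.comp_apply, LinearMap.proj_apply, synthesis]
  rw [add_comm]
  congr 1
  · refine linearRecursion_congr _ _ fun j hj => ?_
    have hjN : j < N := hj.trans i.2
    simp only [zeroExtend, hjN, dite_true, colored]
    rfl
  · simp only [colored, zeroExtend_val]
    rfl

/-- The filter is a unipotent factor times a block-diagonal one. -/
theorem det_finiteSynthesis (N : ℕ) :
    LinearMap.det (M.finiteSynthesis N) = ∏ i : Fin N, (M.root i).det := by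
  rw [finiteSynthesis, map_mul, det_one_add_finiteRecursion, one_mul, LinearMap.det_pi]
  refine Finset.prod_congr rfl fun i _ => ?_
  rw [Matrix.toEuclideanLin, Matrix.toLpLin_eq_toLin, LinearMap.det_toLin]

/-- The whitening filter acting on finite sequences. -/
def finiteWhitening (N : ℕ) :
    (Fin N → EuclideanSpace ℝ (Fin m)) →ₗ[ℝ] (Fin N → EuclideanSpace ℝ (Fin m)) :=
  LinearMap.pi fun i : Fin N => (Matrix.toEuclideanLin (M.root i)⁻¹).comp (LinearMap.proj i) ∘ₗ
    (1 - finiteRecursion (fun i => Matrix.toEuclideanCLM (𝕜 := ℝ) M.A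
      - Matrix.toEuclideanCLM (𝕜 := ℝ) (M.gain i))
      (fun i => Matrix.toEuclideanCLM (𝕜 := ℝ) (M.gain i)) N)

theorem finiteWhitening_apply {N : ℕ} (v : Fin N → EuclideanSpace ℝ (Fin m)) (i : Fin N) :
    M.finiteWhitening N v i
      = Matrix.toEuclideanLin (M.root i)⁻¹ (v i - M.predictor (zeroExtend v) i) := rfl

variable {M}

theorem isUnit_det_root (hσ : 0 < M.σ) (hQ : M.Q.PosSemidef) (hC₀ : M.C₀.PosSemidef) (i : ℕ) :
    IsUnit (M.root i).det := by
  have h := isUnit_det_Re hσ (posSemidef_riccatiSeq hσ hQ hC₀ i)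
  rw [← root_mul_root hσ hQ hC₀, Matrix.det_mul] at h
  exact isUnit_of_mul_isUnit_left h

theorem finiteWhitening_mul_finiteSynthesis (hσ : 0 < M.σ) (hQ : M.Q.PosSemidef)
    (hC₀ : M.C₀.PosSemidef) (N : ℕ) : M.finiteWhitening N * M.finiteSynthesis N = 1 := by
  refine LinearMap.ext fun v => funext fun i => ?_
  rw [Module.End.mul_apply, Module.End.one_apply, finiteWhitening_apply]
  have h1 : M.predictor (zeroExtend (M.finiteSynthesis N v)) i
      = M.predictor (M.synthesis (zeroExtend v)) i := by
    refine predictor_congr fun j hj => ?_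
    have hjN : j < N := hj.trans i.2
    simp only [zeroExtend, hjN, dite_true]
    exact M.finiteSynthesis_apply v ⟨j, hjN⟩
  rw [h1, finiteSynthesis_apply, predictor_synthesis, colored, zeroExtend_val]
  change (Matrix.toEuclideanLin (M.root i)⁻¹) ((Matrix.toEuclideanLin (M.root i)) (v i)) = v i
  rw [Matrix.toEuclideanLin, Matrix.toLpLin_apply, Matrix.toLpLin_apply, Matrix.mulVec_mulVec,
    Matrix.nonsing_inv_mul _ (isUnit_det_root hσ hQ hC₀ i), Matrix.one_mulVec]

/-- The synthesis filter as an automorphism of the Euclidean space of finite sequences, with unit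
noise normalization. -/
def synthesisEquiv (hσ : 0 < M.σ) (hQ : M.Q.PosSemidef) (hC₀ : M.C₀.PosSemidef) (N : ℕ) :
    ObsSpace m N ≃ₗ[ℝ]
      ObsSpace m N :=
  (WithLp.linearEquiv 2 ℝ (Fin N → EuclideanSpace ℝ (Fin m))) ≪≫ₗ
    (LinearEquiv.ofLinearMap (M.finiteSynthesis N) (M.finiteWhitening N)
      (mul_eq_one_comm.1 (finiteWhitening_mul_finiteSynthesis hσ hQ hC₀ N))
      (finiteWhitening_mul_finiteSynthesis hσ hQ hC₀ N)) ≪≫ₗ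
    (LinearEquiv.smulOfNeZero ℝ _ M.σ⁻¹ (inv_ne_zero hσ.ne')) ≪≫ₗ
    (WithLp.linearEquiv 2 ℝ (Fin N → EuclideanSpace ℝ (Fin m))).symm

variable (hσ : 0 < M.σ) (hQ : M.Q.PosSemidef) (hC₀ : M.C₀.PosSemidef) (N : ℕ)

theorem synthesisEquiv_apply (v : ObsSpace m N) (i : Fin N) :
    synthesisEquiv hσ hQ hC₀ N v i = M.σ⁻¹ • M.synthesis (zeroExtend v.ofLp) i := by
  rw [← finiteSynthesis_apply]
  rfl

theorem synthesisEquiv_symm_apply (v : ObsSpace m N)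
    (i : Fin N) : (synthesisEquiv hσ hQ hC₀ N).symm v i = Matrix.toEuclideanLin (M.root i)⁻¹
      (M.σ • v i - M.predictor (zeroExtend (M.σ • v.ofLp)) i) := by
  have h : (synthesisEquiv hσ hQ hC₀ N).symm v i
      = M.finiteWhitening N ((M.σ⁻¹)⁻¹ • v.ofLp) i := rfl
  rw [h, inv_inv, finiteWhitening_apply]
  rfl

theorem det_synthesisEquiv : LinearMap.det (synthesisEquiv hσ hQ hC₀ N :
      ObsSpace m N →ₗ[ℝ] ObsSpace m N)
      = (M.σ⁻¹) ^ (N * m) * ∏ i : Fin N, (M.root i).det := by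
  have h : (synthesisEquiv hσ hQ hC₀ N :
      ObsSpace m N →ₗ[ℝ] ObsSpace m N)
      = ((WithLp.linearEquiv 2 ℝ (Fin N → EuclideanSpace ℝ (Fin m))).symm :
          (Fin N → EuclideanSpace ℝ (Fin m)) →ₗ[ℝ] ObsSpace m N) ∘ₗ (M.σ⁻¹ • M.finiteSynthesis N) ∘ₗ
        ((WithLp.linearEquiv 2 ℝ (Fin N → EuclideanSpace ℝ (Fin m))).symm.symm :
          ObsSpace m N →ₗ[ℝ] (Fin N → EuclideanSpace ℝ (Fin m))) := rfl
  rw [h, LinearMap.det_conj, LinearMap.det_smul, det_finiteSynthesis]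
  congr 2
  simp [Module.finrank_pi_fintype]

theorem log_abs_det_synthesisEquiv : Real.log |LinearMap.det (synthesisEquiv hσ hQ hC₀ N :
      ObsSpace m N →ₗ[ℝ] ObsSpace m N)|
      = ∑ i ∈ Finset.range N, -(1 / 2) *
        Real.log (M.σ ^ (2 * m) / (M.Re (M.riccatiSeq i)).det) := by
  have hterm : ∀ i, -(1 / 2) * Real.log (M.σ ^ (2 * m) / (M.Re (M.riccatiSeq i)).det)
      = Real.log |(M.root i).det| - m * Real.log M.σ := by
    intro i
    have h0 := (isUnit_det_root hσ hQ hC₀ i).ne_zero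
    rw [← root_mul_root hσ hQ hC₀, Matrix.det_mul, Real.log_div (by positivity) (mul_ne_zero h0 h0),
      Real.log_mul h0 h0, Real.log_pow, Real.log_abs]
    push_cast
    ring
  rw [det_synthesisEquiv, Real.log_abs, Real.log_mul (by positivity)
    (Finset.prod_ne_zero_iff.2 fun (i : Fin N) _ => (isUnit_det_root hσ hQ hC₀ i).ne_zero),
    Real.log_pow, Real.log_inv, Real.log_prod fun (i : Fin N) _ => (isUnit_det_root hσ hQ hC₀ i).ne_zero,
    Finset.sum_congr rfl fun i _ => hterm i, Finset.sum_sub_distrib,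
    Fin.sum_univ_eq_sum_range (fun i => Real.log (M.root i).det)]
  simp
  ring

/-- The normalized whitening filter is a contraction. -/
theorem norm_synthesisEquiv_symm_le (v : ObsSpace m N) :
    ‖(synthesisEquiv hσ hQ hC₀ N).symm v‖ ≤ ‖v‖ := by
  set T : ObsSpace m N →ₗ[ℝ] ObsSpace m N :=
    (synthesisEquiv hσ hQ hC₀ N).toLinearMap with hT
  -- The dual claim says that `T Tᵀ`, the covariance of the normalized observations under H₁,
  -- dominates the identity. The excess consists of the nonnegative contributions of `C₀` and `Q` in
  -- the energy identity.
  have hadj : ∀ t, ‖t‖ ≤ ‖LinearMap.adjoint T t‖ := by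
    intro t
    obtain ⟨l, hl, hN⟩ := exists_costate (Matrix.toEuclideanCLM (𝕜 := ℝ) M.A)
      (zeroExtend t.ofLp) N
    set u : ObsSpace m N := WithLp.toLp 2 fun j =>
      M.σ⁻¹ • Matrix.toEuclideanCLM (𝕜 := ℝ) (M.root j) (ContinuousLinearMap.adjoint
        (Matrix.toEuclideanCLM (𝕜 := ℝ) (M.gain j)) (l (j + 1)) + zeroExtend t.ofLp j) with hu
    have h1 : LinearMap.adjoint T t = u := by
      refine ext_inner_right ℝ fun w => ?_
      rw [LinearMap.adjoint_inner_left, PiLp.inner_apply, PiLp.inner_apply]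
      have h2 := sum_inner_synthesis hl hN (zeroExtend w.ofLp)
      rw [← Fin.sum_univ_eq_sum_range (fun j => ⟪zeroExtend t.ofLp j,
        M.synthesis (zeroExtend w.ofLp) j⟫), ← Fin.sum_univ_eq_sum_range (fun j =>
        ⟪Matrix.toEuclideanCLM (𝕜 := ℝ) (M.root j) (ContinuousLinearMap.adjoint
        (Matrix.toEuclideanCLM (𝕜 := ℝ) (M.gain j)) (l (j + 1)) + zeroExtend t.ofLp j),
        zeroExtend w.ofLp j⟫)] at h2
      simp only [zeroExtend_val] at h2
      simp only [hT, LinearEquiv.coe_coe, synthesisEquiv_apply, hu, real_inner_smul_left,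
        real_inner_smul_right, zeroExtend_val, ← Finset.mul_sum, h2]
    have h3 := sum_norm_sq_eq hσ hQ hC₀ hl hN
    have h4 : ‖u‖ ^ 2 = (M.σ⁻¹) ^ 2 * ∑ j ∈ Finset.range N,
        ‖Matrix.toEuclideanCLM (𝕜 := ℝ) (M.root j) (ContinuousLinearMap.adjoint
        (Matrix.toEuclideanCLM (𝕜 := ℝ) (M.gain j)) (l (j + 1)) + zeroExtend t.ofLp j)‖ ^ 2 := by
      rw [PiLp.norm_sq_eq_of_L2, ← Fin.sum_univ_eq_sum_range (fun j =>
        ‖Matrix.toEuclideanCLM (𝕜 := ℝ) (M.root j) (ContinuousLinearMap.adjoint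
        (Matrix.toEuclideanCLM (𝕜 := ℝ) (M.gain j)) (l (j + 1)) + zeroExtend t.ofLp j)‖ ^ 2),
        Finset.mul_sum]
      refine Finset.sum_congr rfl fun j _ => ?_
      simp only [hu, norm_smul, mul_pow, Real.norm_eq_abs, sq_abs]
    have h5 : ‖t‖ ^ 2 = ∑ j ∈ Finset.range N, ‖zeroExtend t.ofLp j‖ ^ 2 := by
      rw [PiLp.norm_sq_eq_of_L2, ← Fin.sum_univ_eq_sum_range
        (fun j => ‖zeroExtend t.ofLp j‖ ^ 2)]
      simp
    have h6 : 0 ≤ (l 0).ofLp ⬝ᵥ M.C₀.mulVec (l 0).ofLp := by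
      simpa using hC₀.dotProduct_mulVec_nonneg (l 0).ofLp
    have h7 : 0 ≤ ∑ j ∈ Finset.range N, M.B.transpose.mulVec (l (j + 1)).ofLp
          ⬝ᵥ M.Q.mulVec (M.B.transpose.mulVec (l (j + 1)).ofLp) :=
      Finset.sum_nonneg fun j _ => by
        simpa using hQ.dotProduct_mulVec_nonneg (M.B.transpose.mulVec (l (j + 1)).ofLp)
    rw [h1, ← sq_le_sq₀ (norm_nonneg _) (norm_nonneg _), h4, h3, h5, mul_add, ← mul_assoc,
      ← mul_pow, inv_mul_cancel₀ hσ.ne', one_pow, one_mul]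
    have : 0 ≤ M.σ⁻¹ ^ 2 * ((l 0).ofLp ⬝ᵥ M.C₀.mulVec (l 0).ofLp
      + ∑ j ∈ Finset.range N, M.B.transpose.mulVec (l (j + 1)).ofLp
          ⬝ᵥ M.Q.mulVec (M.B.transpose.mulVec (l (j + 1)).ofLp)) := by positivity
    linarith
  have hinj : Function.Injective (LinearMap.adjoint T) := by
    rw [← LinearMap.ker_eq_bot, LinearMap.ker_eq_bot']
    intro t ht
    have := hadj t
    rw [ht, norm_zero] at this
    exact norm_le_zero_iff.1 this
  set u := (synthesisEquiv hσ hQ hC₀ N).symm v with hu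
  obtain ⟨t, ht⟩ := LinearMap.injective_iff_surjective.1 hinj u
  have hTu : T u = v := by simp [hT, hu]
  by_contra! hlt
  -- Writing `u = Tᵀ t` gives `‖u‖² = ⟪T u, t⟫ = ⟪v, t⟫`, and `‖t‖ ≤ ‖u‖` by the dual claim.
  have h1 : ‖u‖ ^ 2 ≤ ‖v‖ * ‖u‖ := by
    calc ‖u‖ ^ 2 = ⟪u, LinearMap.adjoint T t⟫ := by rw [ht, real_inner_self_eq_norm_sq]
      _ = ⟪v, t⟫ := by rw [LinearMap.adjoint_inner_right, hTu]
      _ ≤ ‖v‖ * ‖t‖ := real_inner_le_norm _ _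
      _ ≤ ‖v‖ * ‖u‖ := by
        gcongr
        exact (hadj t).trans_eq (by rw [ht])
  nlinarith [norm_nonneg v]

end VectorModel

/-! ### Covariance matrices -/

section CovMatrix

variable {Ω Ω' : Type*} [MeasurableSpace Ω] [MeasurableSpace Ω'] {μ : Measure Ω} {m : ℕ}
  {X Y : Ω → EuclideanSpace ℝ (Fin m)}

/-- The covariance matrix of a random vector. -/
def covMatrix (X : Ω → EuclideanSpace ℝ (Fin m)) (μ : Measure Ω) : Matrix (Fin m) (Fin m) ℝ :=
  Matrix.of fun a b => cov[fun ω => X ω a, fun ω => X ω b; μ]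

theorem MeasureTheory.MemLp.coord {q : ENNReal} (hX : MemLp X q μ) (a : Fin m) :
    MemLp (fun ω => X ω a) q μ :=
  (EuclideanSpace.proj (𝕜 := ℝ) a).comp_memLp' hX

theorem covMatrix_congr (h : X =ᵐ[μ] Y) : covMatrix X μ = covMatrix Y μ := by
  ext a b
  have h' : ∀ a, (fun ω => X ω a) =ᵐ[μ] fun ω => Y ω a := fun a => by
    filter_upwards [h] with ω hω
    rw [hω]
  simp only [covMatrix, Matrix.of_apply, covariance, integral_congr_ae (h' a),
    integral_congr_ae (h' b)]
  refine integral_congr_ae ?_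
  filter_upwards [h] with ω hω
  rw [hω]

theorem covMatrix_map {Z : Ω' → Ω} {ν : Measure Ω'} (hX : Measurable X) (hZ : Measurable Z) :
    covMatrix X (ν.map Z) = covMatrix (fun ω => X (Z ω)) ν := by
  ext a b
  have h' : ∀ a, Measurable fun ω => X ω a := fun a => by fun_prop
  exact covariance_map_fun (h' a).aestronglyMeasurable (h' b).aestronglyMeasurable hZ.aemeasurable

theorem covMatrix_toEuclideanCLM [IsFiniteMeasure μ] (hX : MemLp X 2 μ)
    (F : Matrix (Fin m) (Fin m) ℝ) :
    covMatrix (fun ω => Matrix.toEuclideanCLM (𝕜 := ℝ) F (X ω)) μ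
      = F * covMatrix X μ * F.transpose := by
  ext a b
  have h : ∀ a ω, Matrix.toEuclideanCLM (𝕜 := ℝ) F (X ω) a = ∑ c, F a c * X ω c := fun a ω => by
    rw [Matrix.ofLp_toEuclideanCLM]
    rfl
  simp only [covMatrix, Matrix.of_apply, h, Matrix.mul_apply, Matrix.transpose_apply]
  rw [covariance_fun_sum_fun_sum (fun c => (hX.coord c).const_mul _)
    (fun c => (hX.coord c).const_mul _), Finset.sum_comm]
  refine Finset.sum_congr rfl fun c _ => ?_
  rw [Finset.sum_mul]
  refine Finset.sum_congr rfl fun d _ => ?_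
  rw [covariance_const_mul_left, covariance_const_mul_right]
  ring

theorem covMatrix_smul (c : ℝ) : covMatrix (fun ω => c • X ω) μ = c ^ 2 • covMatrix X μ := by
  ext a b
  simp only [covMatrix, Matrix.of_apply, Matrix.smul_apply, PiLp.smul_apply, smul_eq_mul]
  rw [covariance_const_mul_left, covariance_const_mul_right]
  ring

theorem covMatrix_add [IsFiniteMeasure μ] (hX : MemLp X 2 μ) (hY : MemLp Y 2 μ)
    (h : IndepFun X Y μ) :
    covMatrix (fun ω => X ω + Y ω) μ = covMatrix X μ + covMatrix Y μ := by
  ext a b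
  have hind : ∀ a b, cov[fun ω => X ω a, fun ω => Y ω b; μ] = 0 := fun a b =>
    IndepFun.covariance_eq_zero (h.comp (φ := fun x : EuclideanSpace ℝ (Fin m) => x a)
      (ψ := fun x : EuclideanSpace ℝ (Fin m) => x b) (by fun_prop) (by fun_prop))
      (hX.coord a) (hY.coord b)
  simp only [covMatrix, Matrix.of_apply, Matrix.add_apply, PiLp.add_apply]
  have e : ∀ a, (fun ω => X ω a + Y ω a) = (fun ω => X ω a) + fun ω => Y ω a := fun a => rfl
  rw [e a, e b, covariance_add_left (hX.coord a) (hY.coord a) ((hX.coord b).add (hY.coord b)),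
    covariance_add_right (hX.coord a) (hX.coord b) (hY.coord b),
    covariance_add_right (hY.coord a) (hX.coord b) (hY.coord b), hind a b,
    covariance_comm (fun ω => Y ω a), hind b a]
  ring

theorem covMatrix_sub [IsFiniteMeasure μ] (hX : MemLp X 2 μ) (hY : MemLp Y 2 μ)
    (h : IndepFun X Y μ) :
    covMatrix (fun ω => X ω - Y ω) μ = covMatrix X μ + covMatrix Y μ := by
  have h1 := covMatrix_add hX (hY.const_smul (-1))
    (h.comp (φ := id) (ψ := fun y => (-1 : ℝ) • y) measurable_id (by fun_prop))
  have h2 : covMatrix (fun ω => (-1 : ℝ) • Y ω) μ = covMatrix Y μ := by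
    rw [covMatrix_smul]; simp
  calc covMatrix (fun ω => X ω - Y ω) μ = covMatrix (fun ω => X ω + ((-1 : ℝ) • Y) ω) μ := by
        simp [sub_eq_add_neg]
    _ = covMatrix X μ + covMatrix (fun ω => (-1 : ℝ) • Y ω) μ := h1
    _ = _ := by rw [h2]

theorem integral_norm_sq_eq_trace [IsProbabilityMeasure μ] (hX : MemLp X 2 μ)
    (h0 : ∫ ω, X ω ∂μ = 0) : ∫ ω, ‖X ω‖ ^ 2 ∂μ = (covMatrix X μ).trace := by
  have hmean : ∀ a, ∫ ω, X ω a ∂μ = 0 := fun a => by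
    have := (EuclideanSpace.proj (𝕜 := ℝ) a).integral_comp_comm
      (hX.integrable (by norm_num))
    rw [h0, map_zero] at this
    exact this
  simp_rw [EuclideanSpace.real_norm_sq_eq]
  rw [integral_finsetSum _ fun a _ => (hX.coord a).integrable_sq, Matrix.trace]
  refine Finset.sum_congr rfl fun a _ => ?_
  simp only [Matrix.diag_apply, covMatrix, Matrix.of_apply]
  rw [covariance_eq_sub (hX.coord a) (hX.coord a), hmean]
  simp [pow_two]

end CovMatrix

/-! ### The standard noise -/

section StdNoise

variable {m : ℕ}

theorem measurePreserving_eval_stdNoise (i : ℕ) :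
    MeasurePreserving (fun w : ℕ → EuclideanSpace ℝ (Fin m) => w i) (stdNoise m)
      (stdGaussian (EuclideanSpace ℝ (Fin m))) :=
  measurePreserving_eval_infinitePi _ i

theorem memLp_eval_stdNoise (i : ℕ) :
    MemLp (fun w : ℕ → EuclideanSpace ℝ (Fin m) => w i) 2 (stdNoise m) :=
  (IsGaussian.memLp_two_id (μ := stdGaussian (EuclideanSpace ℝ (Fin m)))).comp_measurePreserving
    (measurePreserving_eval_stdNoise i)

theorem integral_eval_stdNoise (i : ℕ) :
    ∫ w : ℕ → EuclideanSpace ℝ (Fin m), w i ∂(stdNoise m) = 0 := by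
  rw [← integral_id_stdGaussian (E := EuclideanSpace ℝ (Fin m)),
    ← (measurePreserving_eval_stdNoise i).map_eq, integral_map (measurable_pi_apply i).aemeasurable
      (by fun_prop)]

theorem covMatrix_eval_stdNoise (i : ℕ) :
    covMatrix (fun w : ℕ → EuclideanSpace ℝ (Fin m) => w i) (stdNoise m) = 1 := by
  rw [← covMatrix_map (X := fun x => x) measurable_id (by fun_prop),
    (measurePreserving_eval_stdNoise i).map_eq, ← multivariateGaussian_zero_one]
  ext a b
  exact covariance_eval_multivariateGaussian Matrix.PosSemidef.one a b

theorem indepFun_eval_past_stdNoise (i : ℕ) :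
    IndepFun (fun w : ℕ → EuclideanSpace ℝ (Fin m) => w i)
      (fun w (j : Fin i) => w j) (stdNoise m) := by
  have h1 : iIndepFun (fun (i : ℕ) (w : ℕ → EuclideanSpace ℝ (Fin m)) => w i) (stdNoise m) :=
    iIndepFun_infinitePi (X := fun (_ : ℕ) (x : EuclideanSpace ℝ (Fin m)) => x)
      fun _ => measurable_id
  have h2 := h1.indepFun_finset {i} (Finset.range i) (by simp) fun i => measurable_pi_apply i
  exact h2.comp (φ := fun x : ({i} : Finset ℕ) → EuclideanSpace ℝ (Fin m) =>
      x ⟨i, Finset.mem_singleton_self i⟩)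
    (ψ := fun (x : Finset.range i → EuclideanSpace ℝ (Fin m)) (j : Fin i) =>
      x ⟨j, Finset.mem_range.2 j.2⟩) (by fun_prop) (by fun_prop)

/-- A function of the strict past of the noise is independent of the present noise. -/
theorem indepFun_eval_stdNoise {β : Type*} [MeasurableSpace β] {i : ℕ}
    {f : (ℕ → EuclideanSpace ℝ (Fin m)) → β} (hf : Measurable f)
    (hc : ∀ w w', (∀ j < i, w j = w' j) → f w = f w') :
    IndepFun (fun w : ℕ → EuclideanSpace ℝ (Fin m) => w i) f (stdNoise m) := by
  have h := (indepFun_eval_past_stdNoise (m := m) i).comp (φ := id)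
    (ψ := fun v => f (zeroExtend v)) measurable_id (hf.comp measurable_zeroExtend)
  have e : (fun v => f (zeroExtend v)) ∘ (fun (w : ℕ → EuclideanSpace ℝ (Fin m)) (j : Fin i) => w j)
      = f := by
    ext1 w
    exact hc _ _ fun j hj => zeroExtend_restrict w hj
  rwa [e] at h

theorem stdNoise_map_toLp (N : ℕ) :
    (stdNoise m).map (fun w => WithLp.toLp 2 fun i : Fin N => w i)
      = stdGaussian (PiLp 2 fun _ : Fin N => EuclideanSpace ℝ (Fin m)) := by
  have hmeas : Measurable fun w : ℕ → EuclideanSpace ℝ (Fin m) =>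
      (WithLp.toLp 2 fun i : Fin N => w i : PiLp 2 fun _ : Fin N => EuclideanSpace ℝ (Fin m)) := by
    fun_prop
  have := Measure.isProbabilityMeasure_map (μ := stdNoise m) hmeas.aemeasurable
  apply Measure.ext_of_charFun
  ext t
  rw [charFun_stdGaussian, charFun_apply, integral_map hmeas.aemeasurable (by fun_prop)]
  have h1 : ∀ w : ℕ → EuclideanSpace ℝ (Fin m),
      ⟪(WithLp.toLp 2 fun i : Fin N => w i : PiLp 2 fun _ : Fin N => EuclideanSpace ℝ (Fin m)), t⟫
      = ∑ j ∈ Finset.range N, ⟪zeroExtend t.ofLp j, w j⟫ := by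
    intro w
    rw [PiLp.inner_apply, ← Fin.sum_univ_eq_sum_range fun j => ⟪zeroExtend t.ofLp j, w j⟫]
    simp [real_inner_comm]
  simp_rw [h1]
  rw [stdNoise, integral_cexp_sum_infinitePi]
  simp_rw [charFun_stdGaussian]
  rw [← Complex.exp_sum, ← Complex.ofReal_pow, PiLp.norm_sq_eq_of_L2,
    ← Fin.sum_univ_eq_sum_range fun j => -((‖zeroExtend t.ofLp j‖ : ℝ) : ℂ) ^ 2 / 2]
  congr 1
  push_cast
  simp [← Finset.sum_div]

end StdNoise

namespace VectorModel

variable {m p : ℕ} (M : VectorModel m p)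

/-! ### The innovations under `H₀` -/

/-- The innovation under `H₀`, as a function of a standard noise. -/
def nullInnovation (i : ℕ) (w : ℕ → EuclideanSpace ℝ (Fin m)) : EuclideanSpace ℝ (Fin m) :=
  M.σ • w i - M.predictor (M.σ • w) i

theorem measurable_predictor_smul (i : ℕ) : Measurable fun w => M.predictor (M.σ • w) i :=
  (M.measurable_predictor i).comp (by fun_prop)

theorem predictor_succ (y : ℕ → EuclideanSpace ℝ (Fin m)) (i : ℕ) :
    M.predictor y (i + 1) = Matrix.toEuclideanCLM (𝕜 := ℝ) (M.A - M.gain i) (M.predictor y i)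
      + Matrix.toEuclideanCLM (𝕜 := ℝ) (M.gain i) (y i) := by
  rw [map_sub]
  rfl

theorem memLp_predictor (i : ℕ) : MemLp (fun w => M.predictor (M.σ • w) i) 2 (stdNoise m) := by
  induction i with
  | zero => exact MemLp.zero
  | succ i ih =>
    simp only [predictor_succ]
    exact ((Matrix.toEuclideanCLM (𝕜 := ℝ) (M.A - M.gain i)).comp_memLp' ih).add
      ((Matrix.toEuclideanCLM (𝕜 := ℝ) (M.gain i)).comp_memLp'
        ((memLp_eval_stdNoise i).const_smul M.σ))

theorem integral_predictor (i : ℕ) : ∫ w, M.predictor (M.σ • w) i ∂(stdNoise m) = 0 := by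
  induction i with
  | zero => exact integral_zero _ _
  | succ i ih =>
    have h1 : Integrable (fun w => M.predictor (M.σ • w) i) (stdNoise m) :=
      (M.memLp_predictor i).integrable (by norm_num)
    have h2 : Integrable (fun w : ℕ → EuclideanSpace ℝ (Fin m) => (M.σ • w) i) (stdNoise m) :=
      ((memLp_eval_stdNoise i).const_smul M.σ).integrable (by norm_num)
    have h3 : ∫ w : ℕ → EuclideanSpace ℝ (Fin m), (M.σ • w) i ∂(stdNoise m) = 0 := by
      simp only [Pi.smul_apply]
      rw [integral_smul, integral_eval_stdNoise, smul_zero]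
    simp only [predictor_succ]
    rw [integral_add (ContinuousLinearMap.integrable_comp _ h1)
      (ContinuousLinearMap.integrable_comp _ h2), ContinuousLinearMap.integral_comp_comm _ h1,
      ContinuousLinearMap.integral_comp_comm _ h2, ih, h3, map_zero, map_zero, add_zero]

theorem indepFun_eval_predictor (i : ℕ) :
    IndepFun (fun w : ℕ → EuclideanSpace ℝ (Fin m) => w i)
      (fun w => M.predictor (M.σ • w) i) (stdNoise m) :=
  indepFun_eval_stdNoise (M.measurable_predictor_smul i) fun w w' h =>
    predictor_congr fun j hj => by simp [h j hj]

/-- The covariance of the predictor under `H₀`. -/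
def nullPredictorCov (i : ℕ) : Matrix (Fin m) (Fin m) ℝ :=
  covMatrix (fun w => M.predictor (M.σ • w) i) (stdNoise m)

/-- Under H₀ the filter is driven by white noise, and the predictor depends only on strictly earlier
noise, so the covariances of the two terms add. -/
theorem nullPredictorCov_succ (i : ℕ) : M.nullPredictorCov (i + 1)
    = (M.A - M.gain i) * M.nullPredictorCov i * (M.A - M.gain i).transpose
      + M.σ ^ 2 • (M.gain i * (M.gain i).transpose) := by
  have hind := (M.indepFun_eval_predictor i).symm.comp
    (φ := Matrix.toEuclideanCLM (𝕜 := ℝ) (M.A - M.gain i))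
    (ψ := fun x => Matrix.toEuclideanCLM (𝕜 := ℝ) (M.gain i) (M.σ • x)) (by fun_prop) (by fun_prop)
  have hm : MemLp (fun w : ℕ → EuclideanSpace ℝ (Fin m) => M.σ • w i) 2 (stdNoise m) :=
    (memLp_eval_stdNoise i).const_smul M.σ
  have h := covMatrix_add ((Matrix.toEuclideanCLM (𝕜 := ℝ) (M.A - M.gain i)).comp_memLp'
    (M.memLp_predictor i)) ((Matrix.toEuclideanCLM (𝕜 := ℝ) (M.gain i)).comp_memLp' hm) hind
  rw [nullPredictorCov]
  simp only [predictor_succ]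
  refine h.trans ?_
  congr 1
  · exact covMatrix_toEuclideanCLM (M.memLp_predictor i) _
  · refine (covMatrix_toEuclideanCLM hm _).trans ?_
    rw [covMatrix_smul, covMatrix_eval_stdNoise]
    simp

theorem memLp_nullInnovation (i : ℕ) : MemLp (M.nullInnovation i) 2 (stdNoise m) :=
  ((memLp_eval_stdNoise i).const_smul M.σ).sub (M.memLp_predictor i)

theorem integral_nullInnovation (i : ℕ) : ∫ w, M.nullInnovation i w ∂(stdNoise m) = 0 := by
  have h : Integrable (fun w : ℕ → EuclideanSpace ℝ (Fin m) => M.σ • w i) (stdNoise m) :=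
    ((memLp_eval_stdNoise i).const_smul M.σ).integrable (by norm_num)
  unfold nullInnovation
  rw [integral_sub h
    ((M.memLp_predictor i).integrable (by norm_num)), integral_predictor, integral_smul,
    integral_eval_stdNoise, smul_zero, sub_zero]

theorem covMatrix_nullInnovation (i : ℕ) : covMatrix (M.nullInnovation i) (stdNoise m)
    = M.σ ^ 2 • (1 : Matrix (Fin m) (Fin m) ℝ) + M.nullPredictorCov i := by
  have hind := (M.indepFun_eval_predictor i).comp (φ := fun x => M.σ • x) (ψ := id)
    (by fun_prop) measurable_id
  refine (covMatrix_sub ((memLp_eval_stdNoise i).const_smul M.σ) (M.memLp_predictor i)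
    hind).trans ?_
  rw [nullPredictorCov]
  congr 1
  exact (covMatrix_smul M.σ).trans (by rw [covMatrix_eval_stdNoise])

variable {M}

theorem tendsto_covMatrix_nullInnovation {P P' : Matrix (Fin m) (Fin m) ℝ} (hσ : 0 < M.σ)
    (hP : P.PosSemidef) (hlim : Tendsto M.riccatiSeq atTop (𝓝 P))
    (hstab : IsStableMatrix (M.A - M.Kp P)) (hP' : M.IsLyapunovSolution P P') :
    Tendsto (fun i => covMatrix (M.nullInnovation i) (stdNoise m)) atTop
      (𝓝 (M.ReTilde P')) := by
  have hK : Tendsto M.gain atTop (𝓝 (M.Kp P)) := tendsto_Kp hσ hP hlim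
  have hKt : Tendsto (fun i => (M.gain i).transpose) atTop (𝓝 (M.Kp P).transpose) :=
    (continuous_id.matrix_transpose.tendsto _).comp hK
  -- The limiting recursion is the given Lyapunov equation multiplied by `σ²`.
  have hX : M.σ ^ 2 • P' = (M.A - M.Kp P) * (M.σ ^ 2 • P') * (M.A - M.Kp P).transpose
      + M.σ ^ 2 • (M.Kp P * (M.Kp P).transpose) := by
    nth_rw 1 [hP'.lyapunov]
    rw [smul_add, mul_smul_comm, smul_mul_assoc]
  have h := hstab.tendsto_lyapunov hX (hK.const_sub M.A) ((hK.mul hKt).const_smul (M.σ ^ 2))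
    M.nullPredictorCov_succ
  simp only [covMatrix_nullInnovation, ReTilde, smul_add]
  exact h.const_add _

end VectorModel

theorem ProbabilityTheory.IndepFun.of_map {Ω Ω' β γ : Type*} [MeasurableSpace Ω]
    [MeasurableSpace Ω'] [MeasurableSpace β] [MeasurableSpace γ] {μ : Measure Ω} {h : Ω → Ω'}
    {f : Ω' → β} {g : Ω' → γ} (hh : Measurable h) (hf : Measurable f) (hg : Measurable g)
    (hind : IndepFun (fun ω => f (h ω)) (fun ω => g (h ω)) μ) : IndepFun f g (μ.map h) := by
  rw [indepFun_iff_measure_inter_preimage_eq_mul] at hind ⊢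
  intro s t hs ht
  rw [Measure.map_apply hh ((hf hs).inter (hg ht)), Measure.map_apply hh (hf hs),
    Measure.map_apply hh (hg ht)]
  exact hind s t hs ht

theorem integrable_linearRecursion {Ω E : Type*} [MeasurableSpace Ω] {μ : Measure Ω}
    [NormedAddCommGroup E] [NormedSpace ℝ E] (F K : ℕ → E →L[ℝ] E) {e : Ω → ℕ → E}
    (he : ∀ i, Integrable (fun ω => e ω i) μ) (i : ℕ) :
    Integrable (fun ω => linearRecursion F K (e ω) i) μ := by
  induction i with
  | zero => exact integrable_zero _ _ _
  | succ i ih => exact ((F i).integrable_comp ih).add ((K i).integrable_comp (he i))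

namespace VectorModel

variable {m p : ℕ} {M : VectorModel m p}

/-! ### The innovation process -/

theorem measurable_sub_predictor (i : ℕ) :
    Measurable fun y : ℕ → EuclideanSpace ℝ (Fin m) => y i - M.predictor y i :=
  (measurable_pi_apply i).sub (M.measurable_predictor i)

theorem past_le (m i : ℕ) : past m i ≤ MeasurableSpace.pi :=
  Measurable.comap_le (by fun_prop)

theorem stronglyMeasurable_predictor (i : ℕ) :
    StronglyMeasurable[past m i] fun y => M.predictor y i := by
  have h1 : Measurable[past m i] fun y => M.predictor (zeroExtend fun j : Fin i => y j) i :=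
    ((M.measurable_predictor i).comp measurable_zeroExtend).comp
      (comap_measurable fun (y : ℕ → EuclideanSpace ℝ (Fin m)) (j : Fin i) => y j)
  have h2 : (fun y => M.predictor (zeroExtend fun j : Fin i => y j) i)
      = fun y => M.predictor y i := by
    ext1 y
    exact predictor_congr fun j hj => zeroExtend_restrict y hj
  rw [h2] at h1
  exact Measurable.stronglyMeasurable h1

/-- Under `H₁` the conditional mean of an observation given the past is the Kalman predictor. -/
theorem condExp_lawH1 (hσ : 0 < M.σ) (hQ : M.Q.PosSemidef) (hC₀ : M.C₀.PosSemidef) (i : ℕ) :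
    M.lawH1[fun y => y i | past m i] =ᵐ[M.lawH1] fun y => M.predictor y i := by
  have hlaw := lawH1_eq_map_stdNoise hσ hQ hC₀
  have hcol : ∀ i, Integrable (fun w => M.colored w i) (stdNoise m) := fun i =>
    ContinuousLinearMap.integrable_comp _ ((memLp_eval_stdNoise i).integrable (by norm_num))
  have he : Integrable (fun y => y i - M.predictor y i) M.lawH1 := by
    rw [hlaw, integrable_map_measure (measurable_sub_predictor i).aestronglyMeasurable
      M.measurable_synthesis.aemeasurable]
    exact (hcol i).congr (ae_of_all _ fun w => (M.predictor_synthesis w i).symm)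
  have hpred : Integrable (fun y => M.predictor y i) M.lawH1 := by
    rw [hlaw, integrable_map_measure (M.measurable_predictor i).aestronglyMeasurable
      M.measurable_synthesis.aemeasurable]
    refine (integrable_linearRecursion (fun _ => Matrix.toEuclideanCLM (𝕜 := ℝ) M.A)
      (fun i => Matrix.toEuclideanCLM (𝕜 := ℝ) (M.gain i)) hcol i).congr
      (ae_of_all _ fun w => ?_)
    exact (linearRecursion_sub_gain _ _ _ _).symm
  have hmean : ∫ y, (y i - M.predictor y i) ∂M.lawH1 = 0 := by
    rw [hlaw, integral_map M.measurable_synthesis.aemeasurable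
      (measurable_sub_predictor i).aestronglyMeasurable]
    simp_rw [predictor_synthesis, colored]
    rw [ContinuousLinearMap.integral_comp_comm _
      ((memLp_eval_stdNoise i).integrable (by norm_num)), integral_eval_stdNoise, map_zero]
  -- The innovation is a function of the present noise alone, and the earlier observations are
  -- functions of the earlier noise.
  have hind : IndepFun (fun y => y i - M.predictor y i)
      (fun (y : ℕ → EuclideanSpace ℝ (Fin m)) (j : Fin i) => y j) M.lawH1 := by
    rw [hlaw]
    refine IndepFun.of_map M.measurable_synthesis (measurable_sub_predictor i) (by fun_prop) ?_
    simp_rw [predictor_synthesis]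
    have hsynth : Measurable fun w (j : Fin i) => M.synthesis w j :=
      (measurable_pi_lambda _ fun j : Fin i => measurable_pi_apply (j : ℕ)).comp
        M.measurable_synthesis
    exact (indepFun_eval_stdNoise hsynth fun w w' h => funext fun j =>
      synthesis_congr fun k hk => h k (hk.trans_lt j.2)).comp
      (φ := Matrix.toEuclideanCLM (𝕜 := ℝ) (M.root i)) (ψ := id) (by fun_prop) measurable_id
  have hsplit : (fun y : ℕ → EuclideanSpace ℝ (Fin m) => y i)
      = (fun y => M.predictor y i) + fun y => y i - M.predictor y i := by
    ext1 y
    simp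
  have h1 := condExp_add hpred he (past m i)
  have h2 : M.lawH1[fun y => M.predictor y i | past m i] = fun y => M.predictor y i :=
    condExp_of_stronglyMeasurable (past_le m i) (stronglyMeasurable_predictor i) hpred
  have h3 := condExp_indep_eq (measurable_sub_predictor i).comap_le (past_le m i)
    (comap_measurable fun y => y i - M.predictor y i).stronglyMeasurable hind
  rw [hmean] at h3
  rw [← hsplit, h2] at h1
  filter_upwards [h1, h3] with y hy1 hy3
  rw [hy1, Pi.add_apply, hy3, add_zero]

/-! ### Finite-horizon laws and innovation covariances. -/

theorem measurable_obsScale (N : ℕ) :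
    Measurable fun v : ObsSpace m N => M.σ • v.ofLp := by fun_prop

theorem lawH0_map_restrict (N : ℕ) :
    M.lawH0.map (fun y (i : Fin N) => y i)
      = (stdGaussian (ObsSpace m N)).map fun v => M.σ • v.ofLp := by
  rw [lawH0_eq_map_stdNoise, ← stdNoise_map_toLp, Measure.map_map (by fun_prop) (by fun_prop),
    Measure.map_map (by fun_prop) (by fun_prop)]
  rfl

theorem lawH1_map_restrict (hσ : 0 < M.σ) (hQ : M.Q.PosSemidef) (hC₀ : M.C₀.PosSemidef) (N : ℕ) :
    M.lawH1.map (fun y (i : Fin N) => y i)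
      = ((stdGaussian (ObsSpace m N)).map (synthesisEquiv hσ hQ hC₀ N)).map
        fun v => M.σ • v.ofLp := by
  have hT : Measurable (synthesisEquiv hσ hQ hC₀ N) :=
    measurable_linearEquiv _
  rw [lawH1_eq_map_stdNoise hσ hQ hC₀, ← stdNoise_map_toLp,
    Measure.map_map (by fun_prop) M.measurable_synthesis,
    Measure.map_map hT (by fun_prop), Measure.map_map (by fun_prop) (hT.comp (by fun_prop))]
  congr 1
  ext1 w
  ext1 i
  simp only [Function.comp_apply, Pi.smul_apply, synthesisEquiv_apply]
  rw [smul_inv_smul₀ hσ.ne']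
  exact synthesis_congr fun j hj => (zeroExtend_restrict w (hj.trans_lt i.2)).symm

/-- On finitely many observations the law under `H₀` is absolutely continuous with respect to the
law under `H₁`. -/
theorem lawH0_map_restrict_absolutelyContinuous (hσ : 0 < M.σ) (hQ : M.Q.PosSemidef)
    (hC₀ : M.C₀.PosSemidef) (N : ℕ) :
    M.lawH0.map (fun y (i : Fin N) => y i) ≪ M.lawH1.map (fun y (i : Fin N) => y i) := by
  rw [lawH0_map_restrict, lawH1_map_restrict hσ hQ hC₀, stdGaussian_map_linearEquiv]
  have hTm : Measurable (synthesisEquiv hσ hQ hC₀ N).symm :=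
    measurable_linearEquiv _
  refine (withDensity_absolutelyContinuous' (by fun_prop) (ae_of_all _ fun x => ?_)).map
    (measurable_obsScale N)
  exact (ENNReal.ofReal_pos.2 (Real.exp_pos _)).ne'

theorem innovation_ae_eq_lawH1 (hσ : 0 < M.σ) (hQ : M.Q.PosSemidef) (hC₀ : M.C₀.PosSemidef)
    (i : ℕ) : M.innovation i =ᵐ[M.lawH1] fun y => y i - M.predictor y i := by
  filter_upwards [condExp_lawH1 hσ hQ hC₀ i] with y hy
  rw [innovation, hy]

/-- The conditional mean is determined only almost everywhere under H₁. Its equality with the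
predictor is an event of the finite past, where the law under H₀ is absolutely continuous with
respect to that under H₁, so it transfers without comparing the laws of infinite paths. -/
theorem innovation_ae_eq_lawH0 (hσ : 0 < M.σ) (hQ : M.Q.PosSemidef) (hC₀ : M.C₀.PosSemidef)
    (i : ℕ) : M.innovation i =ᵐ[M.lawH0] fun y => y i - M.predictor y i := by
  have hr : Measurable fun (y : ℕ → EuclideanSpace ℝ (Fin m)) (j : Fin i) => y j := by fun_prop
  obtain ⟨s, hs, hs'⟩ : MeasurableSet[past m i]
      {y | (M.lawH1[fun y => y i | past m i]) y = M.predictor y i} :=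
    StronglyMeasurable.measurableSet_eq_fun stronglyMeasurable_condExp
      (stronglyMeasurable_predictor i)
  have h1 : s ∈ ae (M.lawH1.map fun y (j : Fin i) => y j) := by
    rw [mem_ae_map_iff hr.aemeasurable hs, hs']
    exact condExp_lawH1 hσ hQ hC₀ i
  have h2 := (lawH0_map_restrict_absolutelyContinuous hσ hQ hC₀ i).ae_le h1
  rw [mem_ae_map_iff hr.aemeasurable hs, hs'] at h2
  filter_upwards [h2] with y hy
  have hy' : (M.lawH1[fun y => y i | past m i]) y = M.predictor y i := hy
  rw [innovation, hy']

theorem innovationCov_lawH1 (hσ : 0 < M.σ) (hQ : M.Q.PosSemidef) (hC₀ : M.C₀.PosSemidef)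
    (i : ℕ) : M.innovationCov M.lawH1 i = M.Re (M.riccatiSeq i) := by
  have h1 : M.innovationCov M.lawH1 i = covMatrix (M.innovation i) M.lawH1 := rfl
  rw [h1, covMatrix_congr (innovation_ae_eq_lawH1 hσ hQ hC₀ i), lawH1_eq_map_stdNoise hσ hQ hC₀,
    covMatrix_map (measurable_sub_predictor i) M.measurable_synthesis]
  simp_rw [predictor_synthesis, colored]
  rw [covMatrix_toEuclideanCLM (memLp_eval_stdNoise i), covMatrix_eval_stdNoise, mul_one,
    transpose_root, root_mul_root hσ hQ hC₀]

theorem innovationCov_lawH0 (hσ : 0 < M.σ) (hQ : M.Q.PosSemidef) (hC₀ : M.C₀.PosSemidef)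
    (i : ℕ) : M.innovationCov M.lawH0 i = covMatrix (M.nullInnovation i) (stdNoise m) := by
  have h1 : M.innovationCov M.lawH0 i = covMatrix (M.innovation i) M.lawH0 := rfl
  rw [h1, covMatrix_congr (innovation_ae_eq_lawH0 hσ hQ hC₀ i), lawH0_eq_map_stdNoise,
    covMatrix_map (measurable_sub_predictor i) (by fun_prop)]
  rfl

/-! ### The log-likelihood ratio -/

/-- The log-likelihood ratio of `N` normalized observations. -/
def logLikelihood (hσ : 0 < M.σ) (hQ : M.Q.PosSemidef) (hC₀ : M.C₀.PosSemidef) (N : ℕ)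
    (v : ObsSpace m N) : ℝ :=
  Real.log |LinearMap.det (synthesisEquiv hσ hQ hC₀ N : ObsSpace m N →ₗ[ℝ] ObsSpace m N)|
    + (‖(synthesisEquiv hσ hQ hC₀ N).symm v‖ ^ 2 - ‖v‖ ^ 2) / 2

/-- The expected log-likelihood ratio under `H₀` contributed by the observation at time `i`. -/
def exponentIncrement (M : VectorModel m p) (i : ℕ) : ℝ :=
  -(1 / 2) * Real.log (M.σ ^ (2 * m) / (M.Re (M.riccatiSeq i)).det)
    + 1 / 2 * ((M.Re (M.riccatiSeq i))⁻¹ * covMatrix (M.nullInnovation i) (stdNoise m)).trace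
    - (m : ℝ) / 2

theorem measurable_logLikelihood (hσ : 0 < M.σ) (hQ : M.Q.PosSemidef) (hC₀ : M.C₀.PosSemidef)
    (N : ℕ) : Measurable (logLikelihood hσ hQ hC₀ N) := by
  have hTm : Measurable (synthesisEquiv hσ hQ hC₀ N).symm :=
    measurable_linearEquiv _
  unfold logLikelihood
  fun_prop

theorem integral_norm_sq_whitened (hσ : 0 < M.σ) (hQ : M.Q.PosSemidef) (hC₀ : M.C₀.PosSemidef)
    (i : ℕ) : ∫ w, ‖Matrix.toEuclideanCLM (𝕜 := ℝ) (M.root i)⁻¹ (M.nullInnovation i w)‖ ^ 2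
      ∂(stdNoise m) = ((M.Re (M.riccatiSeq i))⁻¹
        * covMatrix (M.nullInnovation i) (stdNoise m)).trace := by
  have hm : MemLp (fun w => Matrix.toEuclideanCLM (𝕜 := ℝ) (M.root i)⁻¹ (M.nullInnovation i w)) 2
      (stdNoise m) := ContinuousLinearMap.comp_memLp' _ (M.memLp_nullInnovation i)
  rw [integral_norm_sq_eq_trace hm,
    covMatrix_toEuclideanCLM (M.memLp_nullInnovation i), Matrix.trace_mul_comm, ← mul_assoc,
    Matrix.transpose_nonsing_inv, transpose_root, ← Matrix.mul_inv_rev,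
    root_mul_root hσ hQ hC₀]
  rw [ContinuousLinearMap.integral_comp_comm _
    ((M.memLp_nullInnovation i).integrable (by norm_num)), integral_nullInnovation, map_zero]

/-- Triangularity splits the determinant and the squared norm into one term per time; the mean of a
squared whitened innovation is a trace. -/
theorem integral_logLikelihood (hσ : 0 < M.σ) (hQ : M.Q.PosSemidef) (hC₀ : M.C₀.PosSemidef)
    (N : ℕ) : ∫ v, logLikelihood hσ hQ hC₀ N v ∂(stdGaussian (ObsSpace m N))
      = ∑ i ∈ Finset.range N, M.exponentIncrement i := by
  have hmeas := measurable_logLikelihood hσ hQ hC₀ N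
  have hto : Measurable fun w : ℕ → EuclideanSpace ℝ (Fin m) =>
      (WithLp.toLp 2 fun i : Fin N => w i : ObsSpace m N) := by fun_prop
  rw [← stdNoise_map_toLp, integral_map hto.aemeasurable hmeas.aestronglyMeasurable]
  have h1 : ∀ w : ℕ → EuclideanSpace ℝ (Fin m),
      logLikelihood hσ hQ hC₀ N (WithLp.toLp 2 fun i : Fin N => w i)
      = ∑ i ∈ Finset.range N, (-(1 / 2) * Real.log (M.σ ^ (2 * m) / (M.Re (M.riccatiSeq i)).det)
        + (‖Matrix.toEuclideanCLM (𝕜 := ℝ) (M.root i)⁻¹ (M.nullInnovation i w)‖ ^ 2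
          - ‖w i‖ ^ 2) / 2) := by
    intro w
    rw [logLikelihood, log_abs_det_synthesisEquiv, Finset.sum_add_distrib, ← Finset.sum_div,
      Finset.sum_sub_distrib, PiLp.norm_sq_eq_of_L2, PiLp.norm_sq_eq_of_L2,
      ← Fin.sum_univ_eq_sum_range fun i => ‖w i‖ ^ 2, ← Fin.sum_univ_eq_sum_range fun i =>
      ‖Matrix.toEuclideanCLM (𝕜 := ℝ) (M.root i)⁻¹ (M.nullInnovation i w)‖ ^ 2]
    congr 4
    ext1 i
    rw [synthesisEquiv_symm_apply]
    congr 2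
    have h2 : M.predictor (zeroExtend (M.σ • fun i : Fin N => w i)) i
        = M.predictor (M.σ • w) i :=
      predictor_congr fun j hj => by
        simp [zeroExtend, hj.trans i.2]
    rw [nullInnovation, ← h2]
    rfl
  simp_rw [h1]
  have hint1 : ∀ i, Integrable (fun w =>
      ‖Matrix.toEuclideanCLM (𝕜 := ℝ) (M.root i)⁻¹ (M.nullInnovation i w)‖ ^ 2) (stdNoise m) :=
    fun i => (ContinuousLinearMap.comp_memLp' _ (M.memLp_nullInnovation i)).integrable_norm_pow
      (by norm_num)
  have hint2 : ∀ i, Integrable (fun w : ℕ → EuclideanSpace ℝ (Fin m) => ‖w i‖ ^ 2) (stdNoise m) :=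
    fun i => (memLp_eval_stdNoise i).integrable_norm_pow (by norm_num)
  have hint3 : ∀ i, Integrable (fun w =>
      (‖Matrix.toEuclideanCLM (𝕜 := ℝ) (M.root i)⁻¹ (M.nullInnovation i w)‖ ^ 2
        - ‖w i‖ ^ 2) / 2) (stdNoise m) := fun i => ((hint1 i).sub (hint2 i)).div_const 2
  have hint4 : ∀ i, Integrable (fun w =>
      -(1 / 2) * Real.log (M.σ ^ (2 * m) / (M.Re (M.riccatiSeq i)).det)
        + (‖Matrix.toEuclideanCLM (𝕜 := ℝ) (M.root i)⁻¹ (M.nullInnovation i w)‖ ^ 2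
          - ‖w i‖ ^ 2) / 2) (stdNoise m) := fun i => (integrable_const _).add (hint3 i)
  rw [integral_finsetSum _ fun i _ => hint4 i]
  refine Finset.sum_congr rfl fun i _ => ?_
  rw [integral_add (integrable_const _) (hint3 i), integral_div, integral_sub (hint1 i) (hint2 i),
    integral_norm_sq_whitened hσ hQ hC₀, integral_norm_sq_eq_trace (memLp_eval_stdNoise i)
    (integral_eval_stdNoise i), covMatrix_eval_stdNoise, exponentIncrement]
  simp
  ring

theorem variance_logLikelihood_le (hσ : 0 < M.σ) (hQ : M.Q.PosSemidef) (hC₀ : M.C₀.PosSemidef)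
    (N : ℕ) : MemLp (logLikelihood hσ hQ hC₀ N) 2 (stdGaussian (ObsSpace m N)) ∧
      Var[logLikelihood hσ hQ hC₀ N; stdGaussian (ObsSpace m N)]
        ≤ N * (m * ((1 / 2) ^ 2 * Var[fun x : ℝ => x ^ 2; gaussianReal 0 1])) := by
  have hdim : Module.finrank ℝ (ObsSpace m N) = N * m := by
    rw [(WithLp.linearEquiv 2 ℝ (Fin N → EuclideanSpace ℝ (Fin m))).finrank_eq]
    simp [Module.finrank_pi_fintype]
  obtain ⟨h1, h2⟩ := variance_norm_sq_sub_le (synthesisEquiv hσ hQ hC₀ N).symm.toLinearMap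
    (norm_synthesisEquiv_symm_le hσ hQ hC₀ N) (Real.log |LinearMap.det
      (synthesisEquiv hσ hQ hC₀ N : ObsSpace m N →ₗ[ℝ] ObsSpace m N)|)
  refine ⟨h1, h2.trans_eq ?_⟩
  rw [hdim, Nat.cast_mul, mul_assoc]

theorem tendsto_exponentIncrement {P P' : Matrix (Fin m) (Fin m) ℝ} (hσ : 0 < M.σ)
    (hP : P.PosSemidef) (hlim : Tendsto M.riccatiSeq atTop (𝓝 P))
    (hstab : IsStableMatrix (M.A - M.Kp P)) (hP' : M.IsLyapunovSolution P P') :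
    Tendsto M.exponentIncrement atTop (𝓝 (M.errorExponent P P')) := by
  have hdet : Tendsto (fun i => (M.Re (M.riccatiSeq i)).det) atTop (𝓝 (M.Re P).det) :=
    ((Continuous.matrix_det continuous_id).tendsto _).comp (hlim.const_add _)
  have hdet0 : 0 < (M.Re P).det := (posDef_Re hσ hP).det_pos
  have hlog : Tendsto (fun i => Real.log (M.σ ^ (2 * m) / (M.Re (M.riccatiSeq i)).det)) atTop
      (𝓝 (Real.log (M.σ ^ (2 * m) / (M.Re P).det))) :=
    (tendsto_const_nhds.div hdet hdet0.ne').log (by positivity)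
  have htr : Tendsto (fun i => ((M.Re (M.riccatiSeq i))⁻¹
      * covMatrix (M.nullInnovation i) (stdNoise m)).trace) atTop
      (𝓝 ((M.Re P)⁻¹ * M.ReTilde P').trace) :=
    ((Continuous.matrix_trace continuous_id).tendsto _).comp
      ((tendsto_inv_Re hσ hP hlim).mul (tendsto_covMatrix_nullInnovation hσ hP hlim hstab hP'))
  exact ((hlog.const_mul _).add (htr.const_mul _)).sub_const _

/-- The normalized log-likelihood ratio converges in probability under `H₀`. -/
theorem tendsto_logLikelihood {κ : ℝ} (hσ : 0 < M.σ) (hQ : M.Q.PosSemidef)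
    (hC₀ : M.C₀.PosSemidef) (hκ : Tendsto M.exponentIncrement atTop (𝓝 κ)) {ε : ℝ} (hε : 0 < ε) :
    Tendsto (fun N : ℕ => (stdGaussian (ObsSpace m N)).real
      {v | ε * N ≤ |logLikelihood hσ hQ hC₀ N v - N * κ|}) atTop (𝓝 0) := by
  set D := m * ((1 / 2) ^ 2 * Var[fun x : ℝ => x ^ 2; gaussianReal 0 1]) with hD
  have hbound : Tendsto (fun N : ℕ => 4 * D / ε ^ 2 / (N : ℝ)) atTop (𝓝 0) :=
    tendsto_const_div_atTop_nhds_zero_nat _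
  refine squeeze_zero' (Eventually.of_forall fun N => measureReal_nonneg) ?_ hbound
  -- Half of `ε` absorbs the bias of the mean, a Cesàro average of the increments; the other half is
  -- left to Chebyshev's inequality.
  have hces := (Metric.tendsto_nhds.1 hκ.cesaro) (ε / 2) (half_pos hε)
  filter_upwards [hces, eventually_gt_atTop 0] with N hN hN0
  have hNpos : (0 : ℝ) < N := by exact_mod_cast hN0
  obtain ⟨hmem, hvar⟩ := variance_logLikelihood_le hσ hQ hC₀ N
  set mean := ∫ v, logLikelihood hσ hQ hC₀ N v ∂(stdGaussian (ObsSpace m N)) with hmean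
  have hmean' : |mean - N * κ| ≤ ε / 2 * N := by
    rw [Real.dist_eq, ← integral_logLikelihood hσ hQ hC₀, ← hmean] at hN
    have e : mean - N * κ = ((N : ℝ)⁻¹ * mean - κ) * N := by field_simp
    rw [e, abs_mul, abs_of_pos hNpos]
    gcongr
  have hcheb := meas_ge_le_variance_div_sq hmem (c := ε / 2 * N) (by positivity)
  have hsub : {v | ε * N ≤ |logLikelihood hσ hQ hC₀ N v - N * κ|}
      ⊆ {v | ε / 2 * N ≤ |logLikelihood hσ hQ hC₀ N v - mean|} := by
    intro v hv
    have hv' : ε * N ≤ |logLikelihood hσ hQ hC₀ N v - N * κ| := hv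
    have := abs_sub_le (logLikelihood hσ hQ hC₀ N v) mean (N * κ)
    change ε / 2 * N ≤ |logLikelihood hσ hQ hC₀ N v - mean|
    linarith
  calc (stdGaussian (ObsSpace m N)).real {v | ε * N ≤ |logLikelihood hσ hQ hC₀ N v - N * κ|}
      ≤ (stdGaussian (ObsSpace m N)).real
          {v | ε / 2 * N ≤ |logLikelihood hσ hQ hC₀ N v - mean|} := measureReal_mono hsub
    _ ≤ Var[logLikelihood hσ hQ hC₀ N; stdGaussian (ObsSpace m N)] / (ε / 2 * N) ^ 2 :=
        ENNReal.toReal_le_of_le_ofReal (div_nonneg (variance_nonneg _ _) (sq_nonneg _)) hcheb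
    _ ≤ N * D / (ε / 2 * N) ^ 2 := by gcongr
    _ = 4 * D / ε ^ 2 / N := by field_simp; ring

/-- Scaling the observations by `σ` is invertible, so it matches tests on the two spaces while
preserving both error probabilities. -/
theorem optimalMissProb_eq (hσ : 0 < M.σ) (hQ : M.Q.PosSemidef) (hC₀ : M.C₀.PosSemidef)
    (α : ℝ) (N : ℕ) : M.optimalMissProb α N = sInf {b | ∃ φ : ObsSpace m N → ℝ,
      (Measurable φ ∧ ∀ y, φ y ∈ Set.Icc (0 : ℝ) 1) ∧ ∫ x, φ x ∂(stdGaussian (ObsSpace m N)) ≤ α ∧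
      ∫ x, (1 - φ x) ∂((stdGaussian (ObsSpace m N)).map (synthesisEquiv hσ hQ hC₀ N)) = b} := by
  have hr : Measurable fun (y : ℕ → EuclideanSpace ℝ (Fin m)) (i : Fin N) => y i := by fun_prop
  have hsc := measurable_obsScale (M := M) N
  have hF : ∀ φ : (Fin N → EuclideanSpace ℝ (Fin m)) → ℝ, Measurable φ → M.falseAlarmProb φ
      = ∫ x : ObsSpace m N, φ (M.σ • x.ofLp) ∂(stdGaussian (ObsSpace m N)) := by
    intro φ hφ
    rw [falseAlarmProb, ← integral_map hr.aemeasurable hφ.aestronglyMeasurable,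
      lawH0_map_restrict, integral_map hsc.aemeasurable hφ.aestronglyMeasurable]
  have hM : ∀ φ : (Fin N → EuclideanSpace ℝ (Fin m)) → ℝ, Measurable φ → M.missProb φ
      = ∫ x : ObsSpace m N, (1 - φ (M.σ • x.ofLp))
        ∂((stdGaussian (ObsSpace m N)).map (synthesisEquiv hσ hQ hC₀ N)) := by
    intro φ hφ
    have hφ' : Measurable fun x => 1 - φ x := measurable_const.sub hφ
    rw [missProb, ← integral_map (f := fun x => 1 - φ x) hr.aemeasurable
      hφ'.aestronglyMeasurable, lawH1_map_restrict hσ hQ hC₀,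
      integral_map hsc.aemeasurable hφ'.aestronglyMeasurable]
  rw [optimalMissProb]
  congr 1
  ext b
  constructor
  · rintro ⟨φ, ⟨hφ, hφ'⟩, h1, h2⟩
    exact ⟨fun x => φ (M.σ • x.ofLp), ⟨hφ.comp hsc, fun y => hφ' _⟩, hF φ hφ ▸ h1, hM φ hφ ▸ h2⟩
  · rintro ⟨φ, ⟨hφ, hφ'⟩, h1, h2⟩
    have hψ : Measurable fun y : Fin N → EuclideanSpace ℝ (Fin m) =>
        φ (WithLp.toLp 2 (M.σ⁻¹ • y)) := hφ.comp (by fun_prop)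
    have e : ∀ x : ObsSpace m N, WithLp.toLp 2 (M.σ⁻¹ • M.σ • x.ofLp) = x := fun x => by
      rw [inv_smul_smul₀ hσ.ne']
    refine ⟨fun y => φ (WithLp.toLp 2 (M.σ⁻¹ • y)), ⟨hψ, fun y => hφ' _⟩, ?_, ?_⟩
    · rw [hF _ hψ]
      simpa only [e] using h1
    · rw [hM _ hψ]
      simpa only [e] using h2

/-- The best error exponent of the miss probability. -/
theorem tendsto_optimalMissProb {κ : ℝ} (hσ : 0 < M.σ) (hQ : M.Q.PosSemidef)
    (hC₀ : M.C₀.PosSemidef) (hκ : Tendsto M.exponentIncrement atTop (𝓝 κ)) {α : ℝ}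
    (hα : α ∈ Set.Ioo (0 : ℝ) 1) : (∀ N, 0 < M.optimalMissProb α N) ∧
      Tendsto (fun N : ℕ => -(1 / (N : ℝ)) * Real.log (M.optimalMissProb α N)) atTop (𝓝 κ) := by
  have hprob : ∀ N, IsProbabilityMeasure
      ((stdGaussian (ObsSpace m N)).map (synthesisEquiv hσ hQ hC₀ N)) := fun N =>
    Measure.isProbabilityMeasure_map
      (measurable_linearEquiv (synthesisEquiv hσ hQ hC₀ N)).aemeasurable
  exact stein_lemma (X := ObsSpace m) (measurable_logLikelihood hσ hQ hC₀)
    (fun N => stdGaussian_map_linearEquiv (synthesisEquiv hσ hQ hC₀ N))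
    (fun ε hε => tendsto_logLikelihood hσ hQ hC₀ hκ hε) hα (optimalMissProb_eq hσ hQ hC₀ α)

end VectorModel

end

/-! ### The main theorem. -/

theorem mainTheorem2 {m p : ℕ} (M : VectorModel m p)
    (hσ : 0 < M.σ) (hQ : M.Q.PosSemidef)
    (hA : IsStableMatrix M.A)
    (hC₀ : M.C₀.PosSemidef)
    (hstat : M.C₀ = M.A * M.C₀ * M.A.transpose + M.B * M.Q * M.B.transpose) :
    ∃ P P' : Matrix (Fin m) (Fin m) ℝ,
      -- `P` is the unique stabilizing solution of the Riccati equation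
      (M.IsStabilizingSolution P ∧ ∀ X, M.IsStabilizingSolution X → X = P) ∧
      P.PosSemidef ∧
      -- `P'` is the unique positive semidefinite solution of the Lyapunov equation
      (M.IsLyapunovSolution P P' ∧ ∀ X, M.IsLyapunovSolution P X → X = P') ∧
      -- the steady-state innovation covariances under `H₁` and `H₀`
      Tendsto (fun i => M.innovationCov M.lawH1 i) atTop (𝓝 (M.Re P)) ∧
      Tendsto (fun i => M.innovationCov M.lawH0 i) atTop (𝓝 (M.ReTilde P')) ∧
      -- the best error exponent of the miss probability, for every level
      ∀ α ∈ Set.Ioo (0 : ℝ) 1,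
        (∀ N, 0 < M.optimalMissProb α N) ∧
        Tendsto (fun N : ℕ => -(1 / (N : ℝ)) * Real.log (M.optimalMissProb α N)) atTop
          (𝓝 (M.errorExponent P P')) := by
  obtain ⟨P, hlim, hP, hfix⟩ := VectorModel.exists_riccati_fixedPoint hσ hQ hC₀ hstat
  have hstab := VectorModel.isStableMatrix_sub_Kp hσ hQ hA hP hfix
  obtain ⟨P', hP'⟩ := VectorModel.exists_isLyapunovSolution hstab
  have hsol : M.IsStabilizingSolution P :=
    ⟨by simpa [Matrix.IsSymm] using hP.1.eq, VectorModel.isUnit_det_Re hσ hP, hfix, hstab⟩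
  refine ⟨P, P', ⟨hsol, fun X hX => hsol.eq hX⟩, hP, ⟨hP', fun X hX => hP'.eq hstab hX⟩, ?_, ?_,
    fun α hα => VectorModel.tendsto_optimalMissProb hσ hQ hC₀
      (VectorModel.tendsto_exponentIncrement hσ hP hlim hstab hP') hα⟩
  · simp_rw [VectorModel.innovationCov_lawH1 hσ hQ hC₀]
    exact hlim.const_add _
  · simp_rw [VectorModel.innovationCov_lawH0 hσ hQ hC₀]
    exact VectorModel.tendsto_covMatrix_nullInnovation hσ hP hlim hstab hP'
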